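/- **Setting.** Let $p$ be a prime, $R$ a commutative ring, $F:R\to R$ a ring endomorphism (for instance a lift of Frobenius), and $q\in R$. Put $(n)_q=1+q+\dots+q^{n-1}$. Assume $(p)_q=0$ in $R$ (for instance $q$ a primitive $p$-th root of unity in a domain) and that $R$ is $q$-divisible: for every $m\in\mathbb N$, $(m)_q$ is invertible if it is nonzero. Let $A$ be a commutative $R$-algebra with a framing $f:R[t]\to A$ (a homomorphism of $R$-algebras, for instance étale, or the $p$-adic completion of an étale one), and $x=f(t)$. Let $\sigma:A\to A$ be an $R$-algebra endomorphism with $\sigma(x)=qx$. Let $A'=R\otimes_{F,R}A$, an $R$-algebra through the left factor, and let $F^*:A'\to A$ be a homomorphism of $R$-algebras with $F^*(1\otimes x)=x^p$. Assume that $F^*$ is a relative Frobenius for the framing that is compatible with $\sigma$, that is: * $1,x,\dots,x^{p-1}$ is a basis of $A$ as an $A'$-module via $F^*$ (equivalently, $F^*$ and $t\mapsto t^p$ form a cocartesian square: $A'\otimes_{R[t],\,t\mapsto t^p}R[t]\cong A$, where $R[t]\to A'$ sends $t$ to $1\otimes x$); * $\sigma\circ F^*=F^*$. There is a unique $R$-linear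 map $\partial_\sigma:A\to A$ with $\partial_\sigma(z_1z_2)=\partial_\sigma(z_1)z_2+\sigma(z_1)\partial_\sigma(z_2)$, $\partial_\sigma(x)=1$ and $\partial_\sigma\circ F^*=0$; if $f$ is étale the last condition follows from the others. A *$\sigma$-derivation* of an $A$-module $M$ is an $R$-linear map $\partial_M:M\to M$ with $\partial_M(am)=\partial_\sigma(a)m+\sigma(a)\partial_M(m)$. An endomorphism $u$ of an abelian group is *quasi-nilpotent* if every element is killed by some power of $u$. Morphisms of modules with a $\sigma$-derivation (resp. with an endomorphism) are the linear maps that commute with these operators. For $n,i\ge 0$ let $$A_{n,i}(u)=\sum_{j=0}^n(-1)^{n-j}u^{p(n-j)(n-j-1)/2}\binom nj_{u^p}\binom{pj}{i}_u\in\mathbb Z[u],$$ and let $B_{n,i}(u)\in\mathbb Z[u]$ be the polynomial with $(i)_u!\,A_{n,i}(u)=(n)_{u^p}!\,(p)_u^n\,B_{n,i}(u)$. Put $$\Phi(\partial_\sigma^n)=\sum_{k=0}^nB_{k,n}(q)\,x^{pk-n}\theta^k\in A[\theta]$$ (the terms with $pk<n$ vanish). **Theorem.** The category of $A$-modules $M$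 with a quasi-nilpotent $\sigma$-derivation $\partial_M$ is equivalent to the category of $A'$-modules $H$ with a quasi-nilpotent $A'$-linear endomorphism $u_H$. The equivalence is given by the following two functors, which are quasi-inverse to each other. * $\mathbb M_q:(H,u_H)\mapsto(A\otimes_{A'}H,\ \partial)$, where $\partial$ is the unique $\sigma$-derivation with $\partial(1\otimes h)=x^{p-1}\otimes u_H(h)$ for all $h\in H$; on morphisms, $g\mapsto \mathrm{id}\otimes g$. * $\mathbb H_q:(M,\partial_M)\mapsto(H,\ u_M|_H)$, where $u_M$ is the unique quasi-nilpotent $A$-linear endomorphism of $M$ such that $\Phi(\partial_\sigma^p)(u_M)=\partial_M^p$ (evaluation at $\theta=u_M$), and $$H=\{m\in M:\ \Phi(\partial_\sigma^k)(u_M)(m)=\partial_M^k(m)\ \text{for all }k\in\mathbb N\},$$ an $A'$-module via $F^*$; morphisms are restricted. The map $\partial_\sigma$ is quasi-nilpotent on $A$, and in this equivalence $(A,\partial_\sigma)$ corresponds to $(A',0)$. -/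

import Mathlib

open Polynomial CategoryTheory
open scoped TensorProduct

universe u

namespace QSimpson

/-! ### Quantum integers -/

/-- The quantum integer `(n)_v = 1 + v + ⋯ + v ^ (n - 1)`, i.e. `(v ^ n - 1) / (v - 1)`. -/
def qInt {S : Type*} [CommRing S] (v : S) (n : ℕ) : S := ∑ i ∈ Finset.range n, v ^ i

/-- The quantum factorial `(n)_v ! = (1)_v (2)_v ⋯ (n)_v`. -/
def qFact {S : Type*} [CommRing S] (v : S) (n : ℕ) : S := ∏ i ∈ Finset.range n, qInt v (i + 1)

/-- The Gaussian binomial coefficient, by the `q`-Pascal rule; it vanishes for `k > n`. -/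
def qBinom {S : Type*} [CommRing S] (v : S) : ℕ → ℕ → S
  | _, 0 => 1
  | 0, _ + 1 => 0
  | n + 1, k + 1 => qBinom v n k + v ^ (k + 1) * qBinom v n (k + 1)

lemma qBinom_eq_zero {S : Type*} [CommRing S] (v : S) :
    ∀ n k : ℕ, n < k → qBinom v n k = 0 := by
  intro n
  induction n with
  | zero => intro k hk; cases k with
    | zero => omega
    | succ k => rfl
  | succ n ih =>
    intro k hk
    cases k with
    | zero => omega
    | succ k => simp [qBinom, ih k (by omega), ih (k + 1) (by omega)]

lemma qInt_add {S : Type*} [CommRing S] (v : S) (m n : ℕ) :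
    qInt v (m + n) = qInt v m + v ^ m * qInt v n := by
  simp [qInt, Finset.sum_range_add, pow_add, Finset.mul_sum]

lemma qFact_succ {S : Type*} [CommRing S] (v : S) (n : ℕ) :
    qFact v (n + 1) = qFact v n * qInt v (n + 1) := by
  simp [qFact, Finset.prod_range_succ]

/-- The Gaussian binomial coefficient is the quotient `(n)_v ! / ((k)_v ! (n - k)_v !)`. -/
lemma qBinom_mul_qFact {S : Type*} [CommRing S] (v : S) :
    ∀ n k : ℕ, qBinom v (n + k) k * (qFact v k * qFact v n) = qFact v (n + k) := by
  suffices h : ∀ N n k : ℕ, n + k = N →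
      qBinom v (n + k) k * (qFact v k * qFact v n) = qFact v (n + k) from
    fun n k => h _ n k rfl
  intro N
  induction N with
  | zero =>
    intro n k h
    obtain ⟨rfl, rfl⟩ : n = 0 ∧ k = 0 := by omega
    simp [qBinom, qFact]
  | succ N ih =>
    intro n k h
    cases k with
    | zero => simp [qBinom, qFact]
    | succ k =>
      have e1 := ih n k (by omega)
      have hq : qFact v (n + (k + 1)) = qFact v (n + k) * qInt v (n + k + 1) := qFact_succ v (n + k)
      have hb : qBinom v (n + (k + 1)) (k + 1)
          = qBinom v (n + k) k + v ^ (k + 1) * qBinom v (n + k) (k + 1) := rfl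
      rw [hq, hb, qFact_succ v k]
      cases n with
      | zero =>
        rw [qBinom_eq_zero v (0 + k) (k + 1) (by omega), ← e1]
        simp
        ring
      | succ n =>
        have e2 := ih n (k + 1) (by omega)
        have h1 : n + (k + 1) = n + 1 + k := by omega
        have h2 : qInt v (n + 1 + k + 1) = qInt v (k + 1) + v ^ (k + 1) * qInt v (n + 1) := by
          rw [← qInt_add]; congr 1; omega
        rw [h1, qFact_succ v k] at e2
        rw [h2, mul_add, ← e1, qFact_succ v n]
        rw [← e1, qFact_succ v n] at e2
        linear_combination (v ^ (k + 1) * qInt v (n + 1)) * e2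

/-! ### The coefficients of the divided Frobenius -/

/-- The polynomial `A_{n,i}` : the coefficient of `∏_{l<i} (T - u ^ l)` in the expansion of
`∏_{j<n} (T ^ p - u ^ (p j))`. -/
noncomputable def coeffA (p n i : ℕ) : ℤ[X] :=
  ∑ j ∈ Finset.range (n + 1), (-1) ^ (n - j) * X ^ (p * (n - j).choose 2) *
    qBinom (X ^ p : ℤ[X]) n j * qBinom (X : ℤ[X]) (p * j) i

/-- The polynomial `B_{n,i}` with `(i)_u ! A_{n,i} = (n)_{u ^ p} ! (p)_u ^ n B_{n,i}`
(an exact division by a monic polynomial). -/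
noncomputable def coeffB (p n i : ℕ) : ℤ[X] :=
  (qFact (X : ℤ[X]) i * coeffA p n i) /ₘ (qFact (X ^ p : ℤ[X]) n * qInt (X : ℤ[X]) p ^ n)

/-- `Φ(∂ ^ n) = ∑_{k ≤ n} B_{k,n}(q) x ^ (p k - n) θ ^ k`, a polynomial over `A` in a variable `θ`.
(`B_{k,n} = 0` when `p k < n`, so the truncated exponent is harmless.) -/
noncomputable def Phi (p : ℕ) {R A : Type u} [CommRing R] [CommRing A] [Algebra R A]
    (q : R) (x : A) (n : ℕ) : A[X] :=
  ∑ k ∈ Finset.range (n + 1),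
    C (algebraMap R A (aeval q (coeffB p k n)) * x ^ (p * k - n)) * X ^ k

/-! ### The Frobenius twist `A' = R ⊗_{F, R} A` -/

/-- The ring `A`, regarded as a `B`-algebra through `φ : B → A`. -/
def Via {B A : Type u} [CommRing B] [CommRing A] (_φ : B →+* A) : Type u := A

instance {B A : Type u} [CommRing B] [CommRing A] (φ : B →+* A) : CommRing (Via φ) :=
  inferInstanceAs (CommRing A)

/-- The identity map, from `A` to `Via φ`. -/
def Via.of {B A : Type u} [CommRing B] [CommRing A] (φ : B →+* A) : A →+* Via φ := RingHom.id A

instance {B A : Type u} [CommRing B] [CommRing A] (φ : B →+* A) : Algebra B (Via φ) :=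
  ((Via.of φ).comp φ).toAlgebra

/-- The base change `A' = R ⊗_{F, R} A` of the `R`-algebra `A` along `F : R → R`. -/
def FrobTwist {R : Type u} [CommRing R] (F : R →+* R) (A : Type u) [CommRing A] [Algebra R A] :
    Type u :=
  Via F ⊗[R] A

noncomputable instance {R : Type u} [CommRing R] (F : R →+* R) (A : Type u) [CommRing A]
    [Algebra R A] : CommRing (FrobTwist F A) :=
  inferInstanceAs (CommRing (Via F ⊗[R] A))

/-- The `R`-algebra structure of `A'` comes from the left factor: `r ↦ r ⊗ 1`. -/
noncomputable instance {R : Type u} [CommRing R] (F : R →+* R) (A : Type u) [CommRing A]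
    [Algebra R A] : Algebra R (FrobTwist F A) :=
  RingHom.toAlgebra (S := Via F ⊗[R] A)
    ((Algebra.TensorProduct.includeLeftRingHom (R := R) (A := Via F) (B := A)).comp
      (Via.of F))

/-- The `F`-semilinear ring homomorphism `A → A'`, `a ↦ 1 ⊗ a`. -/
noncomputable def FrobTwist.of {R : Type u} [CommRing R] (F : R →+* R) (A : Type u) [CommRing A]
    [Algebra R A] : A →+* FrobTwist F A :=
  (Algebra.TensorProduct.includeRight (R := R) (A := Via F) (B := A)).toRingHom

/-! ### Twisted derivations -/

/-- An additive endomorphism each of whose orbits reaches `0`. -/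
def QuasiNilpotent {G : Type*} [AddCommGroup G] (D : G → G) : Prop :=
  ∀ g, ∃ n : ℕ, D^[n] g = 0

/-- `D : M → M` is a `σ`-derivation of the `A`-module `M`, relative to a given
`σ`-derivation `d : A → A`: an `R`-linear map such that `D (a m) = d a • m + σ a • D m`. -/
structure IsSigmaDerivation {R A : Type u} [CommRing R] [CommRing A] [Algebra R A]
    (σ : A →ₐ[R] A) (d : A →+ A) {M : Type u} [AddCommGroup M] [Module A M] (D : M →+ M) :
    Prop where
  map_algebraMap_smul : ∀ (r : R) (m : M), D (algebraMap R A r • m) = algebraMap R A r • D m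
  leibniz : ∀ (a : A) (m : M), D (a • m) = d a • m + σ a • D m

/-! ### The two categories -/

/-- An `A`-module endowed with a quasi-nilpotent `σ`-derivation. -/
structure SigmaModule {R A : Type u} [CommRing R] [CommRing A] [Algebra R A]
    (σ : A →ₐ[R] A) (d : A →+ A) where
  carrier : Type u
  [addCommGroup : AddCommGroup carrier]
  [module : Module A carrier]
  der : carrier →+ carrier
  isSigmaDerivation : IsSigmaDerivation σ d der
  quasiNilpotent : QuasiNilpotent der

attribute [instance] SigmaModule.addCommGroup SigmaModule.module

namespace SigmaModule

variable {R A : Type u} [CommRing R] [CommRing A] [Algebra R A] {σ : A →ₐ[R] A} {d : A →+ A}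

/-- Morphisms are the `A`-linear maps that commute with the `σ`-derivations. -/
@[ext]
structure Hom (M N : SigmaModule σ d) where
  toLin : M.carrier →ₗ[A] N.carrier
  comm : ∀ m, toLin (M.der m) = N.der (toLin m)

instance : Category (SigmaModule σ d) where
  Hom M N := Hom M N
  id M := ⟨LinearMap.id, fun _ => rfl⟩
  comp f g := ⟨g.toLin ∘ₗ f.toLin, fun m => by simp [f.comm, g.comm]⟩

/-- `A` itself with its `σ`-derivation `d`. -/
def self (h : IsSigmaDerivation σ d d) (hn : QuasiNilpotent d) : SigmaModule σ d where
  carrier := A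
  der := d
  isSigmaDerivation := h
  quasiNilpotent := hn

end SigmaModule

/-- A `B`-module endowed with a quasi-nilpotent `B`-linear endomorphism. -/
structure HiggsModule (B : Type u) [CommRing B] where
  carrier : Type u
  [addCommGroup : AddCommGroup carrier]
  [module : Module B carrier]
  endo : carrier →ₗ[B] carrier
  quasiNilpotent : QuasiNilpotent endo

attribute [instance] HiggsModule.addCommGroup HiggsModule.module

namespace HiggsModule

variable {B : Type u} [CommRing B]

/-- Morphisms are the `B`-linear maps that commute with the endomorphisms. -/
@[ext]
structure Hom (H K : HiggsModule B) where
  toLin : H.carrier →ₗ[B] K.carrier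
  comm : ∀ h, toLin (H.endo h) = K.endo (toLin h)

instance : Category (HiggsModule B) where
  Hom H K := Hom H K
  id H := ⟨LinearMap.id, fun _ => rfl⟩
  comp f g := ⟨g.toLin ∘ₗ f.toLin, fun m => by simp [f.comm, g.comm]⟩

/-- The pair `(B, 0)`. -/
def trivial (B : Type u) [CommRing B] : HiggsModule B where
  carrier := B
  endo := 0
  quasiNilpotent := fun _ => ⟨1, rfl⟩

end HiggsModule

/-! ### The explicit functors -/

section Pullback

variable {A B : Type u} [CommRing A] [CommRing B] (φ : B →+* A)
  (H : Type u) [AddCommGroup H] [Module B H]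

/-- The `A`-module `A ⊗_B H`, where `A` is a `B`-algebra through `φ : B → A`. -/
def Pullback : Type u := Via φ ⊗[B] H

noncomputable instance : AddCommGroup (Pullback φ H) :=
  inferInstanceAs (AddCommGroup (Via φ ⊗[B] H))

noncomputable instance : Module A (Pullback φ H) :=
  Module.compHom (Via φ ⊗[B] H) (Via.of φ)

variable {H} in
/-- The elementary tensor `a ⊗ h` in `A ⊗_B H`. -/
def Pullback.tmul (a : A) (h : H) : Pullback φ H := Via.of φ a ⊗ₜ[B] h

end Pullback

section Functors

variable (p : ℕ) {R A : Type u} [CommRing R] [CommRing A] [Algebra R A] (q : R) (x : A)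
  {σ : A →ₐ[R] A} {d : A →+ A}

/-- The defining condition on the operator `u` of a module with `σ`-derivation `∂`: it is `A`-linear
and quasi-nilpotent, and `∂ ^ p = Φ(∂ ^ p)(u)`. -/
def IsHiggsOperator (M : SigmaModule σ d) (u : Module.End A M.carrier) : Prop :=
  QuasiNilpotent u ∧ ∀ m, aeval u (Phi p q x p) m = M.der^[p] m

/-- The set of all `m` such that `Φ(∂ ^ k)(u) m = ∂ ^ k m` for every `k`. -/
def higgsSet (M : SigmaModule σ d) (u : Module.End A M.carrier) : Set M.carrier :=
  {m | ∀ k : ℕ, aeval u (Phi p q x k) m = M.der^[k] m}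

variable {B : Type u} [CommRing B] (φ : B →+* A)

/-- The functor `𝓗` is (up to natural isomorphism) `M ↦ (higgsSet M u, u)`, where `u` is the
operator of `M`, the `B`-module structure comes from `φ`, and morphisms are restricted. -/
def IsFunctorH (𝓗 : SigmaModule σ d ⥤ HiggsModule B) : Prop :=
  ∃ ι : ∀ M : SigmaModule σ d, (𝓗.obj M).carrier →+ M.carrier,
    (∀ M, Function.Injective (ι M)) ∧
    (∀ M b h, ι M (b • h) = φ b • ι M h) ∧
    (∀ M (u : Module.End A M.carrier), IsHiggsOperator p q x M u →
      Set.range (ι M) = higgsSet p q x M u ∧ ∀ h, ι M ((𝓗.obj M).endo h) = u (ι M h)) ∧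
    (∀ (M N : SigmaModule σ d) (f : M ⟶ N) (h : (𝓗.obj M).carrier),
      ι N ((𝓗.map f).toLin h) = f.toLin (ι M h))

/-- The functor `𝓜` is (up to natural isomorphism) `(H, u) ↦ A ⊗_B H`, with the `σ`-derivation
such that `∂ (1 ⊗ h) = x ^ (p - 1) ⊗ u h`, and `g ↦ id ⊗ g` on morphisms. -/
def IsFunctorM (𝓜 : HiggsModule B ⥤ SigmaModule σ d) : Prop :=
  ∃ e : ∀ H : HiggsModule B, Pullback φ H.carrier ≃ₗ[A] (𝓜.obj H).carrier,
    (∀ H h, (𝓜.obj H).der (e H (Pullback.tmul φ 1 h)) =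
      e H (Pullback.tmul φ (x ^ (p - 1)) (H.endo h))) ∧
    (∀ (H K : HiggsModule B) (g : H ⟶ K) (a : A) (h : H.carrier),
      (𝓜.map g).toLin (e H (Pullback.tmul φ a h)) = e K (Pullback.tmul φ a (g.toLin h)))

end Functors

end QSimpson

namespace QSimpson

/-! ### Identities between quantum integers -/

section Quantum

variable {S : Type*} [CommRing S] (v : S)

/-! Write `B` for `A'`, `y` for the element of `B` mapping to `x ^ p`, and `D` for the
`σ`-derivation of a module `M`. Since `σ` fixes `B` and `∂_σ` kills it, `D` is `B`-linear, and all
that matters is the relation `D (x m) = m + q x D m`. The powers of `x` span `A` over `B`, so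
commuting with `x` amounts to `A`-linearity. From `(p)_q = 0` and `q ^ p = 1` it follows that `D ^
p` is `A`-linear (`iterate_prime_smul`).

Existence of `u`. The coefficients `B_{k,n}` obey a two-term recursion (`coeffB_eq`). Hence `Φ(∂ ^
p) = c θ + θ ^ 2 r(θ)` with coefficients in `B` and `c = (p-1)_q !`, a unit. Such a polynomial has a
compositional inverse as a power series; evaluated at the locally nilpotent `D ^ p`, this gives the
unique quasi-nilpotent `u` (`isHiggs_iff`). It commutes with every morphism, in particular with `D`.

Descent. Put `∇ = D - x ^ (p - 1) u`. The recursion for `B_{k,n}` gives `D Φ_n(u) = Φ_{n+1}(u) + q⁻ⁿ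
Φ_n(u) ∇`, hence a binomial formula for `D ^ n` in base `q⁻¹` (`iterate_eq_sum_aeval_Phi`). Thus the
conditions that define `H` all follow from `∇ m = 0`. For `n = p` the middle binomials vanish, so `D
^ p = Φ_p(u) + ∇ ^ p`, and the equation for `u` says exactly that `∇ ^ p = 0`. On `H = ker ∇` one
finds `∇ (x ^ (n+1) h) = (n+1)_q x ^ n g(h)`, where `g = 1 - (1 - q) y u` is an automorphism because
`u` is quasi-nilpotent. So `∇` acts on the translates `x ^ i H` like a twisted `d/dx`; as `(i)_q !`
is invertible for `i < p`, `M` is the direct sum of the `x ^ i H` with `i < p`, that is `A ⊗ H ≃ M`.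

Conversely, on `A ⊗ H` the operator `id ⊗ u` solves the defining equation, and the same direct sum
decomposition shows that `ker ∇` is `1 ⊗ H`. -/

@[simp] lemma qInt_zero : qInt v 0 = 0 := by simp [qInt]

@[simp] lemma qInt_one : qInt v 1 = 1 := by simp [qInt]

lemma qInt_succ (n : ℕ) : qInt v (n + 1) = 1 + v * qInt v n := by
  rw [add_comm, qInt_add]; simp

lemma qInt_mul (m n : ℕ) : qInt v (m * n) = qInt v m * qInt (v ^ m) n := by
  induction n with
  | zero => simp
  | succ n ih => rw [Nat.mul_succ, qInt_add, ih, qInt_add, pow_mul]; simp; ring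

lemma map_qInt {T : Type*} [CommRing T] (g : S →+* T) (n : ℕ) :
    g (qInt v n) = qInt (g v) n := by simp [qInt]

lemma pow_mul_qInt_sub {m n : ℕ} (h : n ≤ m) :
    v ^ n * qInt v (m - n) = qInt v m - qInt v n := by
  rw [eq_sub_iff_add_eq, add_comm, ← qInt_add, Nat.add_sub_cancel' h]

lemma sub_one_mul_qInt (n : ℕ) : (v - 1) * qInt v n = v ^ n - 1 := by
  rw [qInt, mul_comm, geom_sum_mul]

@[simp] lemma qBinom_zero_right (n : ℕ) : qBinom v n 0 = 1 := by cases n <;> rfl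

lemma qBinom_succ_succ (n k : ℕ) :
    qBinom v (n + 1) (k + 1) = qBinom v n k + v ^ (k + 1) * qBinom v n (k + 1) := rfl

@[simp] lemma qBinom_self (n : ℕ) : qBinom v n n = 1 := by
  induction n with
  | zero => rfl
  | succ n ih => simp [qBinom_succ_succ, ih, qBinom_eq_zero v n (n + 1) (by omega)]

/-- The recursion of the Gaussian binomial coefficients in the lower index. -/
lemma pow_mul_qInt_mul_qBinom (m n : ℕ) :
    v ^ n * qInt v (n + 1) * qBinom v m (n + 1) = (qInt v m - qInt v n) * qBinom v m n := by
  induction m generalizing n with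
  | zero =>
    cases n with
    | zero => simp [qBinom]
    | succ n => simp [qBinom]
  | succ m ih =>
    cases n with
    | zero =>
      have h := ih 0
      simp only [pow_zero, zero_add, qInt_one, one_mul, qInt_zero, sub_zero,
        qBinom_zero_right, mul_one] at h ⊢
      simp [qBinom, h, qInt_succ]
    | succ k =>
      have h1 := ih k
      have h2 := ih (k + 1)
      simp only [qBinom_succ_succ, qInt_succ v m, qInt_succ v (k + 1)] at h2 ⊢
      rw [qInt_succ] at h1 h2 ⊢
      linear_combination v ^ (k + 2) * h2 + v * h1

end Quantum

/-! ### The coefficients of the divided Frobenius -/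

section Coefficients

lemma monic_qInt_X_pow {p : ℕ} (hp : 0 < p) (n : ℕ) : (qInt (X ^ p : ℤ[X]) (n + 1)).Monic := by
  induction n with
  | zero => simp
  | succ n ih =>
    rw [qInt_succ, add_comm]
    have h : (X ^ p * qInt (X ^ p : ℤ[X]) (n + 1)).Monic := (monic_X_pow p).mul ih
    refine h.add_of_left ?_
    rw [degree_one, degree_mul, degree_X_pow, degree_eq_natDegree ih.ne_zero]
    norm_cast
    omega

lemma monic_qFact_X_pow {p : ℕ} (hp : 0 < p) (n : ℕ) : (qFact (X ^ p : ℤ[X]) n).Monic :=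
  monic_prod_of_monic _ _ fun i _ => monic_qInt_X_pow hp i

/-- The denominator of `B_{k, n}`. -/
noncomputable def coeffDen (p k : ℕ) : ℤ[X] := qFact (X ^ p : ℤ[X]) k * qInt (X : ℤ[X]) p ^ k

/-- Monicity makes `/ₘ` in `coeffB` return the exact quotient once the numerator is known to be a
multiple of the denominator. -/
lemma monic_coeffDen {p : ℕ} (hp : 0 < p) (k : ℕ) : (coeffDen p k).Monic := by
  refine (monic_qFact_X_pow hp k).mul (Monic.pow ?_ k)
  obtain ⟨m, rfl⟩ : ∃ m, p = m + 1 := ⟨p - 1, by omega⟩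
  simpa using monic_qInt_X_pow one_pos m

lemma coeffDen_succ (p k : ℕ) :
    coeffDen p (k + 1) = coeffDen p k * qInt (X : ℤ[X]) (p * (k + 1)) := by
  rw [coeffDen, coeffDen, qFact_succ, qInt_mul]; ring

/-- The coefficients of the `q`-binomial inversion. -/
noncomputable def invCoeff (p k j : ℕ) : ℤ[X] :=
  (-1) ^ (k - j) * X ^ (p * (k - j).choose 2) * qBinom (X ^ p : ℤ[X]) k j

lemma qBinom_succ_mul_qInt {p : ℕ} (hp : 0 < p) (n j : ℕ) :
    qBinom (X ^ p : ℤ[X]) (n + 1 + j) j * qInt (X ^ p : ℤ[X]) (n + 1)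
      = qInt (X ^ p : ℤ[X]) (n + 1 + j) * qBinom (X ^ p : ℤ[X]) (n + j) j := by
  have h1 := qBinom_mul_qFact (X ^ p : ℤ[X]) (n + 1) j
  have h2 := qBinom_mul_qFact (X ^ p : ℤ[X]) n j
  have h3 : n + 1 + j = n + j + 1 := by omega
  have hn := (monic_qFact_X_pow hp n).ne_zero
  have hj := (monic_qFact_X_pow hp j).ne_zero
  refine mul_left_cancel₀ (mul_ne_zero hj hn) ?_
  rw [h3] at h1 ⊢
  rw [qFact_succ, qFact_succ, ← h2] at h1
  linear_combination h1

/-- The ratio of consecutive inversion coefficients. It turns the factor `(pj)_u`, which depends on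
the summation index, into `(p(k+1))_u` at the cost of a sum with `k` in place of `k + 1`. -/
lemma invCoeff_succ_mul {p : ℕ} (hp : 0 < p) {k j : ℕ} (h : j ≤ k) :
    invCoeff p (k + 1) j * (qInt X (p * (k + 1)) - qInt X (p * j))
      = -(qInt X (p * (k + 1)) * X ^ (p * k) * invCoeff p k j) := by
  obtain ⟨n, rfl⟩ : ∃ n, k = n + j := ⟨k - j, by omega⟩
  rw [← pow_mul_qInt_sub _ (Nat.mul_le_mul_left p (by omega : j ≤ n + j + 1)), ← Nat.mul_sub]
  have e1 : n + j + 1 - j = n + 1 := by omega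
  have e2 : n + j - j = n := by omega
  have h1 := qBinom_succ_mul_qInt hp n j
  rw [show n + 1 + j = n + j + 1 by omega] at h1
  rw [invCoeff, invCoeff, e1, e2, qInt_mul, qInt_mul, Nat.choose_succ_succ' n 1, Nat.choose_one_right]
  have e3 : (X : ℤ[X]) ^ (p * (n + n.choose 2)) * X ^ (p * j)
      = X ^ (p * (n + j)) * X ^ (p * n.choose 2) := by ring
  linear_combination (-1) ^ (n + 1) * X ^ (p * (n + n.choose 2)) * X ^ (p * j) * qInt X p * h1
    + (-1) ^ (n + 1) * qInt X p * qInt (X ^ p) (n + j + 1) * qBinom (X ^ p) (n + j) j * e3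

/-- The alternating sum is the product of the `1 - u ^ (p i)` for `i < k`, whose factor at `i = 0`
is zero. -/
lemma sum_invCoeff (p k : ℕ) :
    ∑ j ∈ Finset.range (k + 1), invCoeff p k j = if k = 0 then 1 else 0 := by
  suffices h : ∀ k, ∑ j ∈ Finset.range (k + 2), invCoeff p (k + 1) j
      = (1 - X ^ (p * k)) * ∑ j ∈ Finset.range (k + 1), invCoeff p k j by
    cases k with
    | zero => simp [invCoeff]
    | succ k =>
      rw [if_neg (by omega)]
      induction k with
      | zero => rw [h]; simp
      | succ k ih => rw [h, ih, mul_zero]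
  intro k
  have h0 : invCoeff p (k + 1) 0 = -(X ^ (p * k) * invCoeff p k 0) := by
    simp only [invCoeff, Nat.sub_zero, qBinom_zero_right, Nat.choose_succ_succ' k 1,
      Nat.choose_one_right]
    ring
  have hs : ∀ j ∈ Finset.range (k + 1), invCoeff p (k + 1) (j + 1)
      = invCoeff p k j - X ^ (p * k) * invCoeff p k (j + 1) := by
    intro j hj
    rw [Finset.mem_range] at hj
    rw [invCoeff, invCoeff, invCoeff, qBinom_succ_succ, Nat.succ_sub_succ]
    rcases Nat.lt_or_ge j k with hjk | hjk
    · obtain ⟨n, rfl⟩ : ∃ n, k = j + 1 + n := ⟨k - j - 1, by omega⟩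
      rw [show j + 1 + n - j = n + 1 by omega, show j + 1 + n - (j + 1) = n by omega,
        Nat.choose_succ_succ' n 1, Nat.choose_one_right]
      ring
    · rw [qBinom_eq_zero _ k (j + 1) (by omega)]
      ring
  have hl : invCoeff p k (k + 1) = 0 := by
    rw [invCoeff, qBinom_eq_zero _ k (k + 1) (by omega), mul_zero]
  rw [Finset.sum_range_succ', Finset.sum_congr rfl hs, Finset.sum_sub_distrib, h0,
    ← Finset.mul_sum]
  have h2 := Finset.sum_range_succ' (invCoeff p k) (k + 1)
  rw [Finset.sum_range_succ, hl, add_zero] at h2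
  rw [sub_mul, one_mul]
  nth_rewrite 3 [h2]
  ring

/-- The product `(n)_u ! A_{k, n}`. -/
noncomputable def coeffNum (p k n : ℕ) : ℤ[X] := qFact (X : ℤ[X]) n * coeffA p k n

lemma coeffNum_eq_sum (p k n : ℕ) : coeffNum p k n = ∑ j ∈ Finset.range (k + 1),
    invCoeff p k j * (qFact (X : ℤ[X]) n * qBinom (X : ℤ[X]) (p * j) n) := by
  rw [coeffNum, coeffA, Finset.mul_sum]
  refine Finset.sum_congr rfl fun j _ => ?_
  rw [invCoeff]; ring

lemma coeffNum_zero_right (p k : ℕ) : coeffNum p k 0 = if k = 0 then 1 else 0 := by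
  rw [coeffNum_eq_sum, ← sum_invCoeff p k]
  simp [qFact]

lemma X_pow_mul_qFact_mul_qBinom (m n : ℕ) :
    X ^ n * (qFact (X : ℤ[X]) (n + 1) * qBinom (X : ℤ[X]) m (n + 1))
      = (qInt X m - qInt X n) * (qFact (X : ℤ[X]) n * qBinom (X : ℤ[X]) m n) := by
  rw [qFact_succ]
  linear_combination qFact (X : ℤ[X]) n * pow_mul_qInt_mul_qBinom (X : ℤ[X]) m n

lemma X_pow_mul_coeffNum_zero (p n : ℕ) :
    X ^ n * coeffNum p 0 (n + 1) = - (qInt X n * coeffNum p 0 n) := by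
  have h := X_pow_mul_qFact_mul_qBinom 0 n
  rw [coeffNum_eq_sum, coeffNum_eq_sum]
  simp only [zero_add, Finset.sum_range_one, mul_zero, qInt_zero] at h ⊢
  linear_combination invCoeff p 0 0 * h

/-- Termwise, raising `n` multiplies by `(pj)_u - (n)_u`, which is `((p(k+1))_u - (n)_u) -
((p(k+1))_u - (pj)_u)`. The first difference is constant in `j`; `invCoeff_succ_mul` absorbs the
second. -/
lemma X_pow_mul_coeffNum_succ {p : ℕ} (hp : 0 < p) (k n : ℕ) :
    X ^ n * coeffNum p (k + 1) (n + 1) = (qInt X (p * (k + 1)) - qInt X n) * coeffNum p (k + 1) n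
      + qInt X (p * (k + 1)) * X ^ (p * k) * coeffNum p k n := by
  rw [coeffNum_eq_sum, coeffNum_eq_sum p k n, Finset.sum_range_succ, coeffNum_eq_sum,
    Finset.sum_range_succ _ (k + 1), mul_add (X ^ n), mul_add (_ - _), Finset.mul_sum, Finset.mul_sum,
    Finset.mul_sum, add_right_comm, ← Finset.sum_add_distrib]
  congr 1
  · refine Finset.sum_congr rfl fun j hj => ?_
    rw [Finset.mem_range] at hj
    have h1 := X_pow_mul_qFact_mul_qBinom (p * j) n
    have h2 := invCoeff_succ_mul hp (by omega : j ≤ k)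
    linear_combination invCoeff p (k + 1) j * h1
      - (qFact (X : ℤ[X]) n * qBinom (X : ℤ[X]) (p * j) n) * h2
  · linear_combination invCoeff p (k + 1) (k + 1) * X_pow_mul_qFact_mul_qBinom (p * (k + 1)) n

/-- A recursive description of `B_{k, n}`; see `coeffB_eq`. -/
noncomputable def recB (p : ℕ) : ℕ → ℕ → ℤ[X]
  | 0, k => if k = 0 then 1 else 0
  | _ + 1, 0 => 0
  | n + 1, k + 1 => qInt X (p * (k + 1) - n) * recB p n (k + 1) + X ^ (p * k - n) * recB p n k

/-- This vanishing makes the truncated subtractions in `recB` harmless: at the boundary `p (k + 1) =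
n` the factor `(0)_u` kills the term, and beyond it everything is already zero. -/
lemma recB_eq_zero_of_mul_lt {p : ℕ} (hp : 0 < p) :
    ∀ n k : ℕ, p * k < n → recB p n k = 0 := by
  intro n
  induction n with
  | zero => intro k h; omega
  | succ n ih =>
    intro k h
    cases k with
    | zero => rfl
    | succ k =>
      have h1 : recB p n k = 0 := ih k (by rw [Nat.mul_succ] at h; omega)
      rw [recB, h1, mul_zero, add_zero, show p * (k + 1) - n = 0 by omega, qInt_zero, zero_mul]

lemma recB_eq_zero_of_lt (p : ℕ) : ∀ n k : ℕ, n < k → recB p n k = 0 := by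
  intro n
  induction n with
  | zero => intro k h; rw [recB, if_neg (by omega)]
  | succ n ih =>
    intro k h
    cases k with
    | zero => omega
    | succ k => rw [recB, ih _ (by omega), ih _ (by omega), mul_zero, mul_zero, add_zero]

lemma X_pow_mul_recB_succ {p : ℕ} (hp : 0 < p) (n k : ℕ) :
    X ^ n * recB p (n + 1) (k + 1) = (qInt X (p * (k + 1)) - qInt X n) * recB p n (k + 1)
      + X ^ (p * k) * recB p n k := by
  have h1 : X ^ n * qInt X (p * (k + 1) - n) * recB p n (k + 1)
      = (qInt X (p * (k + 1)) - qInt X n) * recB p n (k + 1) := by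
    rcases Nat.lt_or_ge (p * (k + 1)) n with h | h
    · rw [recB_eq_zero_of_mul_lt hp n _ h, mul_zero, mul_zero]
    · rw [pow_mul_qInt_sub _ h]
  have h2 : X ^ n * X ^ (p * k - n) * recB p n k = X ^ (p * k) * recB p n k := by
    rcases Nat.lt_or_ge (p * k) n with h | h
    · rw [recB_eq_zero_of_mul_lt hp n _ h, mul_zero, mul_zero]
    · rw [← pow_add, Nat.add_sub_cancel' h]
  rw [recB]
  linear_combination h1 + h2

lemma coeffNum_eq {p : ℕ} (hp : 0 < p) (n k : ℕ) :
    coeffNum p k n = coeffDen p k * recB p n k := by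
  induction n generalizing k with
  | zero =>
    rw [coeffNum_zero_right, recB]
    split_ifs with h
    · simp [h, coeffDen, qFact]
    · simp
  | succ n ih =>
    -- Both recursions are free of truncated differences only after multiplication by `u ^ n`, which
    -- can be cancelled in `ℤ[u]`.
    refine mul_left_cancel₀ (pow_ne_zero n (X_ne_zero (R := ℤ))) ?_
    cases k with
    | zero =>
      rw [X_pow_mul_coeffNum_zero, ih]
      cases n with
      | zero => simp [recB]
      | succ n => simp [recB]
    | succ k =>
      have h := X_pow_mul_recB_succ hp n k
      rw [X_pow_mul_coeffNum_succ hp, ih, ih, coeffDen_succ]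
      linear_combination -coeffDen p k * qInt (X : ℤ[X]) (p * (k + 1)) * h

lemma coeffB_eq {p : ℕ} (hp : 0 < p) (k n : ℕ) : coeffB p k n = recB p n k := by
  have h := coeffNum_eq hp n k
  rw [coeffNum] at h
  rw [coeffB, h]
  exact mul_divByMonic_cancel_left _ (monic_coeffDen hp k)

end Coefficients

/-! ### Inverting a polynomial on locally nilpotent endomorphisms -/

lemma iterate_eq_zero_of_le {G : Type*} [AddCommGroup G] {D : G →+ G} {g : G} {m n : ℕ}
    (hmn : m ≤ n) (h : D^[m] g = 0) : D^[n] g = 0 := by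
  obtain ⟨k, rfl⟩ := Nat.exists_eq_add_of_le' hmn
  rw [Function.iterate_add_apply, h, iterate_map_zero]

section Inverse

variable {B : Type*} [CommRing B]

/-- Successive approximations of the compositional inverse of `c X + X ^ 2 r`, where `c` is a unit
with inverse `c'`. -/
noncomputable def compInv (c' : B) (r : B[X]) : ℕ → B[X]
  | 0 => 0
  | n + 1 => C c' * (X - (X ^ 2 * r).comp (compInv c' r n))

/-- A series starting in degree two contracts `X`-adically on multiples of `X`; this drives the
convergence of the fixed-point iteration `compInv`. -/
lemma X_pow_succ_dvd_comp_sub_comp (r : B[X]) {a b : B[X]} (ha : X ∣ a) (hb : X ∣ b) {n : ℕ}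
    (h : X ^ n ∣ a - b) : X ^ (n + 1) ∣ (X ^ 2 * r).comp a - (X ^ 2 * r).comp b := by
  have h1 : a - b ∣ r.comp a - r.comp b := by
    simpa [comp, eval₂_eq_eval_map] using sub_dvd_eval_sub a b (r.map C)
  have h2 : (X ^ 2 * r).comp a - (X ^ 2 * r).comp b
      = a * (a * (r.comp a - r.comp b)) + (a - b) * ((a + b) * r.comp b) := by
    simp only [mul_comp, pow_comp, X_comp]; ring
  rw [h2]
  refine dvd_add ?_ ?_
  · rw [pow_succ']
    exact mul_dvd_mul ha ((h.trans h1).mul_left a)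
  · rw [pow_succ]
    exact mul_dvd_mul h ((dvd_add ha hb).mul_right _)

lemma X_dvd_comp_of_X_dvd (r : B[X]) {a : B[X]} (ha : X ∣ a) : X ∣ (X ^ 2 * r).comp a := by
  simp only [mul_comp, pow_comp, X_comp]
  exact (dvd_pow ha two_ne_zero).mul_right _

variable (c' : B) (r : B[X])

lemma X_dvd_compInv (n : ℕ) : X ∣ compInv c' r n := by
  induction n with
  | zero => exact dvd_zero _
  | succ n ih => exact (dvd_sub dvd_rfl (X_dvd_comp_of_X_dvd r ih)).mul_left _

lemma X_pow_dvd_compInv_succ_sub (n : ℕ) :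
    X ^ (n + 1) ∣ compInv c' r (n + 1) - compInv c' r n := by
  induction n with
  | zero =>
    simp [compInv]
  | succ n ih =>
    have h := X_pow_succ_dvd_comp_sub_comp r (X_dvd_compInv c' r (n + 1)) (X_dvd_compInv c' r n) ih
    rw [compInv, compInv, ← mul_sub, sub_sub_sub_cancel_left, ← neg_sub, mul_neg]
    exact (h.mul_left _).neg_right

lemma X_pow_dvd_compInv_sub {m n : ℕ} (h : m ≤ n) :
    X ^ m ∣ compInv c' r n - compInv c' r m := by
  induction n, h using Nat.le_induction with
  | base => simp
  | succ n hmn ih =>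
    have h := (pow_dvd_pow X (by omega : m ≤ n + 1)).trans (X_pow_dvd_compInv_succ_sub c' r n)
    simpa using dvd_add h ih

variable {c' r} {c : B} (hc : c * c' = 1)

include hc in
lemma X_pow_dvd_comp_compInv_sub (n : ℕ) :
    X ^ (n + 1) ∣ (C c * X + X ^ 2 * r).comp (compInv c' r n) - X := by
  have hC : (C c * C c' : B[X]) = 1 := by rw [← C_mul, hc, C_1]
  -- The error of the `n`-th approximation is, up to the unit `-c`, the next increment of the
  -- iteration.
  have h : (C c * X + X ^ 2 * r).comp (compInv c' r n) - X
      = -(C c * (compInv c' r (n + 1) - compInv c' r n)) := by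
    rw [compInv, add_comp, mul_comp, C_comp, X_comp]
    linear_combination (X - (X ^ 2 * r).comp (compInv c' r n)) * hC
  rw [h]
  exact ((X_pow_dvd_compInv_succ_sub c' r n).mul_left _).neg_right

include hc in
-- Being an inverse on the other side, which gives uniqueness of `u`, follows by the same
-- contraction argument: each step gains one power of `X`.
lemma X_pow_dvd_compInv_comp_sub (n : ℕ) :
    X ^ (n + 1) ∣ (compInv c' r n).comp (C c * X + X ^ 2 * r) - X := by
  have hC : (C c * C c' : B[X]) = 1 := by rw [← C_mul, hc, C_1]
  induction n with
  | zero => simp [compInv]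
  | succ n ih =>
    set a := (compInv c' r n).comp (C c * X + X ^ 2 * r) with ha
    have hX : X ∣ a := by
      simpa using dvd_add ((dvd_pow_self X (Nat.succ_ne_zero n)).trans ih) (dvd_refl (X : B[X]))
    have h1 := X_pow_succ_dvd_comp_sub_comp r hX dvd_rfl ih
    have h : (compInv c' r (n + 1)).comp (C c * X + X ^ 2 * r) - X
        = -(C c' * ((X ^ 2 * r).comp a - (X ^ 2 * r).comp X)) := by
      rw [compInv, mul_comp, C_comp, sub_comp, X_comp, comp_assoc, ← ha, comp_X]
      linear_combination X * hC
    rw [h]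
    exact (h1.mul_left _).neg_right

variable {M : Type*} [AddCommGroup M] [Module B M]

lemma aeval_apply_eq_zero {P : Module.End B M} {m : M} {N : ℕ} (hm : P^[N] m = 0) {g : B[X]}
    (hg : X ^ N ∣ g) : aeval P g m = 0 := by
  obtain ⟨g, rfl⟩ := hg
  rw [mul_comm, map_mul, Module.End.mul_apply, map_pow, aeval_X, Module.End.pow_apply, hm, map_zero]

lemma aeval_apply_eq_of_dvd_sub {P : Module.End B M} {m : M} {N : ℕ} (hm : P^[N] m = 0)
    {g h : B[X]} (hg : X ^ N ∣ g - h) : aeval P g m = aeval P h m := by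
  rw [← sub_eq_zero, ← LinearMap.sub_apply, ← map_sub]
  exact aeval_apply_eq_zero hm hg

lemma map_aeval_apply {M' : Type*} [AddCommGroup M'] [Module B M'] {P : Module.End B M}
    {P' : Module.End B M'} (f : M →ₗ[B] M') (hf : ∀ m, f (P m) = P' (f m)) (g : B[X]) (m : M) :
    f (aeval P g m) = aeval P' g (f m) := by
  induction g using Polynomial.induction_on' generalizing m with
  | add g h hg hh => simp [hg, hh]
  | monomial n b =>
    have : ∀ m, f ((P ^ n) m) = (P' ^ n) (f m) := by
      intro m
      simp only [Module.End.pow_apply]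
      exact (Function.Semiconj.iterate_right (f := f) (ga := P) (gb := P') hf n) m
    simp [aeval_monomial, this, Module.algebraMap_end_apply]

lemma aeval_compInv_eq {P : Module.End B M} {m : M} {N N' : ℕ} (hm : P^[N] m = 0)
    (hm' : P^[N'] m = 0) :
    aeval P (compInv c' r N) m = aeval P (compInv c' r N') m := by
  rcases le_total N N' with h | h
  · exact (aeval_apply_eq_of_dvd_sub hm (X_pow_dvd_compInv_sub c' r h)).symm
  · exact aeval_apply_eq_of_dvd_sub hm' (X_pow_dvd_compInv_sub c' r h)

variable (c' r) in
/-- The compositional inverse of `c X + X ^ 2 r`, evaluated at a locally nilpotent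
endomorphism. -/
noncomputable def evalCompInv (P : Module.End B M) (hP : QuasiNilpotent P) : Module.End B M where
  toFun m := aeval P (compInv c' r (hP m).choose) m
  map_add' m n := by
    have hm := iterate_eq_zero_of_le (D := P.toAddMonoidHom)
      (le_max_left (hP m).choose (hP n).choose) (hP m).choose_spec
    have hn := iterate_eq_zero_of_le (D := P.toAddMonoidHom)
      (le_max_right (hP m).choose (hP n).choose) (hP n).choose_spec
    have hmn : P^[max (hP m).choose (hP n).choose] (m + n) = 0 := by
      rw [← Module.End.pow_apply, map_add, Module.End.pow_apply, Module.End.pow_apply]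
      erw [hm, hn]; rw [add_zero]
    rw [aeval_compInv_eq (hP (m + n)).choose_spec hmn, aeval_compInv_eq (hP m).choose_spec hm,
      aeval_compInv_eq (hP n).choose_spec hn, map_add]
  map_smul' b m := by
    have hm : P^[(hP m).choose] (b • m) = 0 := by
      rw [← Module.End.pow_apply, map_smul, Module.End.pow_apply, (hP m).choose_spec, smul_zero]
    rw [aeval_compInv_eq (hP (b • m)).choose_spec hm, map_smul, RingHom.id_apply]

/-- The approximations agree modulo `X ^ N` from stage `N` on, so any `N` that kills `m` computes
the same value. -/
lemma evalCompInv_apply {P : Module.End B M} (hP : QuasiNilpotent P) {m : M} {N : ℕ}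
    (hm : P^[N] m = 0) : evalCompInv c' r P hP m = aeval P (compInv c' r N) m :=
  aeval_compInv_eq (hP m).choose_spec hm

lemma map_evalCompInv {M' : Type*} [AddCommGroup M'] [Module B M'] {P : Module.End B M}
    {P' : Module.End B M'} (hP : QuasiNilpotent P) (hP' : QuasiNilpotent P') (f : M →ₗ[B] M')
    (hf : ∀ m, f (P m) = P' (f m)) (m : M) :
    f (evalCompInv c' r P hP m) = evalCompInv c' r P' hP' (f m) := by
  obtain ⟨N, hN⟩ := hP m
  have hN' : P'^[N] (f m) = 0 := by
    rw [← (Function.Semiconj.iterate_right (f := f) (ga := P) (gb := P') hf N) m, hN, map_zero]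
  rw [evalCompInv_apply hP hN, evalCompInv_apply hP' hN', map_aeval_apply f hf]

lemma iterate_evalCompInv_apply {P : Module.End B M} (hP : QuasiNilpotent P) {m : M} {N : ℕ}
    (hm : P^[N] m = 0) (n : ℕ) :
    (evalCompInv c' r P hP)^[n] m = aeval P (compInv c' r N ^ n) m := by
  induction n with
  | zero => simp
  | succ n ih =>
    have h0 : P^[N] (aeval P (compInv c' r N ^ n) m) = 0 := by
      rw [← Module.End.pow_apply, map_aeval_apply (P ^ N) (P' := P)
        (fun m => by rw [← Module.End.mul_apply, ← pow_succ, pow_succ', Module.End.mul_apply]),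
        Module.End.pow_apply, hm, map_zero]
    rw [Function.iterate_succ_apply', ih, evalCompInv_apply hP h0, ← Module.End.mul_apply,
      ← map_mul, pow_succ']

lemma quasiNilpotent_evalCompInv {P : Module.End B M} (hP : QuasiNilpotent P) :
    QuasiNilpotent (evalCompInv c' r P hP) := by
  intro m
  obtain ⟨N, hN⟩ := hP m
  exact ⟨N, by rw [iterate_evalCompInv_apply hP hN]
               exact aeval_apply_eq_zero hN (pow_dvd_pow_of_dvd (X_dvd_compInv c' r N) N)⟩

lemma aeval_evalCompInv_apply {P : Module.End B M} (hP : QuasiNilpotent P) {m : M} {N : ℕ}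
    (hm : P^[N] m = 0) (g : B[X]) :
    aeval (evalCompInv c' r P hP) g m = aeval P (g.comp (compInv c' r N)) m := by
  induction g using Polynomial.induction_on' with
  | add g h hg hh => simp [hg, hh]
  | monomial n b =>
    simp [aeval_monomial, Module.End.pow_apply, iterate_evalCompInv_apply hP hm,
      Module.algebraMap_end_apply]

include hc in
lemma aeval_evalCompInv {P : Module.End B M} (hP : QuasiNilpotent P) :
    aeval (evalCompInv c' r P hP) (C c * X + X ^ 2 * r) = P := by
  ext m
  obtain ⟨N, hN⟩ := hP m
  rw [aeval_evalCompInv_apply hP hN, aeval_apply_eq_of_dvd_sub hN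
    ((pow_dvd_pow X N.le_succ).trans (X_pow_dvd_comp_compInv_sub hc N)), aeval_X]

include hc in
lemma eq_evalCompInv {P : Module.End B M} (hP : QuasiNilpotent P) {v : Module.End B M}
    (hv : QuasiNilpotent v) (h : aeval v (C c * X + X ^ 2 * r) = P) :
    v = evalCompInv c' r P hP := by
  ext m
  obtain ⟨N, hN⟩ := hP m
  obtain ⟨K, hK⟩ := hv m
  have hN' : P^[max N K] m = 0 :=
    iterate_eq_zero_of_le (D := P.toAddMonoidHom) (le_max_left N K) hN
  have hK' : v^[max N K] m = 0 :=
    iterate_eq_zero_of_le (D := v.toAddMonoidHom) (le_max_right N K) hK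
  -- Evaluating the left inverse at `v` gives back `v m`, while by `h` it is the approximation
  -- evaluated at `P`; the exponent is large enough for both operators.
  have h1 := aeval_apply_eq_of_dvd_sub hK'
    ((pow_dvd_pow X (Nat.le_succ _)).trans (X_pow_dvd_compInv_comp_sub (r := r) hc (max N K)))
  rw [aeval_comp, h, aeval_X] at h1
  rw [evalCompInv_apply hP hN', h1]

end Inverse
/-! ### Specialization at a root of unity -/

section RootOfUnity

variable {B : Type*} [CommRing B] {q : B} {p : ℕ}

lemma pow_eq_one_of_qInt_eq_zero (hq : qInt q p = 0) : q ^ p = 1 := by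
  have h := sub_one_mul_qInt q p
  rw [hq, mul_zero] at h
  exact (sub_eq_zero.mp h.symm)

lemma qInt_mul_eq_zero (hq : qInt q p = 0) (n : ℕ) : qInt q (p * n) = 0 := by
  rw [qInt_mul, hq, zero_mul]

/-- If `(m)_q = 0`, choose `s` with `m s ≡ 1` modulo `p`. Then `0 = (m s)_q = (1)_q = 1`, so the
ring is zero and every element is a unit. -/
lemma isUnit_qInt_of_divisible (hp : p.Prime) (hq : qInt q p = 0)
    (hdiv : ∀ m : ℕ, qInt q m ≠ 0 → IsUnit (qInt q m)) {m : ℕ} (h0 : 0 < m) (hm : m < p) :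
    IsUnit (qInt q m) := by
  by_contra h
  have hm0 : qInt q m = 0 := by
    by_contra h'
    exact h (hdiv m h')
  obtain ⟨s, -, hs⟩ := Nat.exists_mul_mod_eq_one_of_coprime
    (Nat.coprime_of_lt_prime h0.ne' hm hp).symm hp.one_lt
  have h1 : qInt q (m * s) = 0 := qInt_mul_eq_zero hm0 s
  rw [← Nat.mod_add_div (m * s) p, hs, qInt_add, qInt_mul_eq_zero hq, qInt_one, mul_zero,
    add_zero] at h1
  exact h (by rw [hm0, ← h1]; exact isUnit_one)

/-- `q ^ (p - 1)` is the inverse of `q`. -/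
lemma mul_pow_pred (hp : 0 < p) (hq : qInt q p = 0) : q * q ^ (p - 1) = 1 := by
  rw [← pow_succ', Nat.sub_add_cancel hp, pow_eq_one_of_qInt_eq_zero hq]

lemma pow_mul_qInt_inv {v : B} (hv : q * v = 1) (n : ℕ) :
    q ^ n * qInt v (n + 1) = qInt q (n + 1) := by
  induction n with
  | zero => simp
  | succ n ih =>
    have h : q ^ (n + 1) * v ^ (n + 1) = 1 := by rw [← mul_pow, hv, one_pow]
    rw [qInt_succ q, ← ih, qInt_add v (n + 1) 1, qInt_one]
    linear_combination h

lemma isUnit_qFact (hu : ∀ m, 0 < m → m < p → IsUnit (qInt q m)) {n : ℕ} (hn : n < p) :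
    IsUnit (qFact q n) := by
  induction n with
  | zero => simp [qFact]
  | succ n ih => rw [qFact_succ]; exact (ih (by omega)).mul (hu _ (by omega) hn)

lemma qBinom_eq_zero_of_qInt_eq_zero (hq : qInt q p = 0)
    (hu : ∀ m, 0 < m → m < p → IsUnit (qInt q m)) {k : ℕ} (h0 : 0 < k) (hk : k < p) :
    qBinom q p k = 0 := by
  obtain ⟨n, rfl⟩ : ∃ n, p = n + k := ⟨p - k, by omega⟩
  have h := qBinom_mul_qFact q n k
  have h1 : qFact q (n + k) = 0 := by
    obtain ⟨m, hm⟩ : ∃ m, n + k = m + 1 := ⟨n + k - 1, by omega⟩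
    rw [hm, qFact_succ, ← hm, hq, mul_zero]
  rw [h1] at h
  exact (((isUnit_qFact hu hk).mul (isUnit_qFact hu (by omega : n < n + k))).mul_left_eq_zero).mp h

/-- The quantum integers in base `q⁻¹ = q ^ (p - 1)` differ from those in base `q` by powers of the
unit `q`, so the same ones vanish or are invertible. -/
lemma qBinom_inv_eq_zero (hp : 0 < p) (hq : qInt q p = 0)
    (hu : ∀ m, 0 < m → m < p → IsUnit (qInt q m)) {k : ℕ} (h0 : 0 < k) (hk : k < p) :
    qBinom (q ^ (p - 1)) p k = 0 := by
  have hv := mul_pow_pred hp hq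
  have hqu : IsUnit q := IsUnit.of_mul_eq_one _ hv
  refine qBinom_eq_zero_of_qInt_eq_zero ?_ (fun m hm0 hm => ?_) h0 hk
  · obtain ⟨n, rfl⟩ : ∃ n, p = n + 1 := ⟨p - 1, by omega⟩
    refine ((hqu.pow n).mul_right_eq_zero).mp ?_
    rw [pow_mul_qInt_inv hv, hq]
  · obtain ⟨n, rfl⟩ : ∃ n, m = n + 1 := ⟨m - 1, by omega⟩
    have h := hu _ hm0 hm
    rw [← pow_mul_qInt_inv hv] at h
    exact isUnit_of_mul_isUnit_right h

/-- The specialization of `B_{k, n}` at `q`. -/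
noncomputable def evalB (p : ℕ) (q : B) (n k : ℕ) : B := aeval q (recB p n k)

lemma evalB_zero_zero : evalB p q 0 0 = 1 := by simp [evalB, recB]

lemma evalB_succ_zero (n : ℕ) : evalB p q (n + 1) 0 = 0 := by simp [evalB, recB]

lemma evalB_succ_succ (n k : ℕ) : evalB p q (n + 1) (k + 1) =
    qInt q (p * (k + 1) - n) * evalB p q n (k + 1) + q ^ (p * k - n) * evalB p q n k := by
  simp [evalB, recB, qInt]

lemma evalB_eq_zero_of_mul_lt (hp : 0 < p) {n k : ℕ} (h : p * k < n) : evalB p q n k = 0 := by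
  rw [evalB, recB_eq_zero_of_mul_lt hp n k h, map_zero]

lemma evalB_eq_zero_of_lt {n k : ℕ} (h : n < k) : evalB p q n k = 0 := by
  rw [evalB, recB_eq_zero_of_lt p n k h, map_zero]

lemma evalB_one_one : evalB p q 1 1 = 1 := by
  rw [evalB_succ_succ, evalB_zero_zero, evalB_eq_zero_of_lt (by omega)]; simp

/-- For `k = 1` the recursion has a single term, and the value is the product of the `(p - i)_q`
with `1 ≤ i ≤ n`. -/
lemma isUnit_evalB_one (hu : ∀ m, 0 < m → m < p → IsUnit (qInt q m)) {n : ℕ} (hn : n < p) :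
    IsUnit (evalB p q (n + 1) 1) := by
  induction n with
  | zero => rw [evalB_one_one]; exact isUnit_one
  | succ n ih =>
    rw [evalB_succ_succ, evalB_succ_zero, mul_zero, add_zero]
    exact (hu _ (by omega) (by omega)).mul (ih (by omega))

end RootOfUnity

/-! ### Twisted derivations with `∂ (x m) = m + q x ∂ m` -/

section Twisted

variable {B A M : Type u} [CommRing B] [CommRing A] [Algebra B A] [AddCommGroup M] [Module A M]
  [Module B M] [IsScalarTower B A M] {p : ℕ} {q y : B} {x : A}

lemma algebraMap_aeval_coeffB_smul (hp : 0 < p) (n k : ℕ) (m : M) :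
    algebraMap B A (aeval q (coeffB p k n)) • m = evalB p q n k • m := by
  rw [coeffB_eq hp, algebraMap_smul, evalB]

lemma aeval_Phi_apply (hp : 0 < p) (u : Module.End A M) (n : ℕ) (m : M) :
    aeval u (Phi p q x n) m =
      ∑ k ∈ Finset.range (n + 1), evalB p q n k • x ^ (p * k - n) • (u ^ k) m := by
  simp only [Phi, map_sum, LinearMap.sum_apply, map_mul, aeval_C, map_pow, aeval_X,
    Module.End.mul_apply, Module.algebraMap_end_apply, algebraMap_aeval_coeffB_smul hp]
  simp only [← map_pow, Module.algebraMap_end_apply]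

variable {D : M →ₗ[B] M}

lemma map_pow_smul_of_map_smul (hD : ∀ m, D (x • m) = m + q • x • D m) (n : ℕ) (m : M) :
    D (x ^ n • m) = qInt q n • x ^ (n - 1) • m + q ^ n • x ^ n • D m := by
  induction n generalizing m with
  | zero => simp
  | succ n ih =>
    rw [pow_succ, mul_smul, ih, hD, Nat.add_sub_cancel, qInt_add, qInt_one, mul_one, pow_succ]
    have h : qInt q n • x ^ (n - 1) • x • m = qInt q n • x ^ n • m := by
      cases n with
      | zero => simp
      | succ n => rw [Nat.add_sub_cancel, ← mul_smul, ← pow_succ]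
    rw [h, smul_add, smul_add, smul_comm (x ^ n) q, ← mul_smul (q ^ n) q, ← mul_smul (x ^ n) x,
      add_smul, add_assoc]

omit [Algebra B A] [IsScalarTower B A M] in
lemma iterate_map_smul (hD : ∀ m, D (x • m) = m + q • x • D m) (n : ℕ) (m : M) :
    D^[n] (x • m) = qInt q n • D^[n - 1] m + q ^ n • x • D^[n] m := by
  induction n with
  | zero => simp
  | succ n ih =>
    rw [Function.iterate_succ_apply', ih, map_add, map_smul, map_smul, hD,
      Function.iterate_succ_apply', Nat.add_sub_cancel, qInt_add, qInt_one, mul_one, pow_succ]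
    have h : qInt q n • D (D^[n - 1] m) = qInt q n • D^[n] m := by
      cases n with
      | zero => simp
      | succ n => rw [Nat.add_sub_cancel, ← Function.iterate_succ_apply' D]
    rw [h, smul_add, ← mul_smul (q ^ n) q, add_smul, add_assoc]

variable (p x D) in
/-- The operator `∂ - x ^ (p - 1) u`. -/
def nabla (u : Module.End A M) : Module.End B M := D - (x ^ (p - 1) • u).restrictScalars B

lemma nabla_apply (u : Module.End A M) (m : M) :
    nabla p x D u m = D m - x ^ (p - 1) • u m := rfl

lemma aeval_Phi_zero_apply (hp : 0 < p) (u : Module.End A M) (m : M) :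
    aeval u (Phi p q x 0) m = m := by
  rw [aeval_Phi_apply hp]; simp [evalB_zero_zero]

lemma aeval_Phi_one_apply (hp : 0 < p) (u : Module.End A M) (m : M) :
    aeval u (Phi p q x 1) m = x ^ (p - 1) • u m := by
  rw [aeval_Phi_apply hp]
  simp [Finset.sum_range_succ, evalB_one_one, evalB_succ_zero 0]

/-- Substituting `D m = x ^ (p - 1) u m + ∇ m` in each monomial gives three terms. The first two
reassemble into `Φ_{n+1}` by the recursion of `B_{k,n}`; the third carries `q ^ (pk - n) = q⁻ⁿ`,
independent of `k`. -/
lemma map_aeval_Phi (hp : 0 < p) (hq : qInt q p = 0) (hD : ∀ m, D (x • m) = m + q • x • D m)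
    {u : Module.End A M} (hu : ∀ m, D (u m) = u (D m)) (n : ℕ) (m : M) :
    D (aeval u (Phi p q x n) m) = aeval u (Phi p q x (n + 1)) m
      + (q ^ (p - 1)) ^ n • aeval u (Phi p q x n) (nabla p x D u m) := by
  have hup : ∀ k m, D ((u ^ k) m) = (u ^ k) (D m) := by
    intro k m
    rw [Module.End.pow_apply, Module.End.pow_apply]
    exact (Function.Semiconj.iterate_right (f := D) (ga := u) (gb := u) hu k) m
  have hDm : D m = x ^ (p - 1) • u m + nabla p x D u m := by rw [nabla_apply]; abel
  have hT : ∀ k, D (evalB p q n k • x ^ (p * k - n) • (u ^ k) m)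
      = (qInt q (p * k - n) * evalB p q n k) • x ^ (p * k - (n + 1)) • (u ^ k) m
        + (q ^ (p * k - n) * evalB p q n k) • x ^ (p * (k + 1) - (n + 1)) • (u ^ (k + 1)) m
        + (q ^ (p - 1)) ^ n • evalB p q n k • x ^ (p * k - n) • (u ^ k) (nabla p x D u m) := by
    intro k
    rcases Nat.lt_or_ge (p * k) n with h | h
    · simp [evalB_eq_zero_of_mul_lt hp h]
    · have h1 : q ^ (p * k - n) = (q ^ (p - 1)) ^ n := by
        have h2 : q ^ n * (q ^ (p - 1)) ^ n = 1 := by rw [← mul_pow, mul_pow_pred hp hq, one_pow]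
        have h3 : q ^ n * q ^ (p * k - n) = 1 := by
          rw [← pow_add, Nat.add_sub_cancel' h, pow_mul, pow_eq_one_of_qInt_eq_zero hq, one_pow]
        linear_combination (q ^ (p - 1)) ^ n * h3 - q ^ (p * k - n) * h2
      have h4 : p * (k + 1) - (n + 1) = (p * k - n) + (p - 1) := by
        rw [Nat.mul_succ]; omega
      rw [map_smul, map_pow_smul_of_map_smul hD, hup, hDm, map_add, map_smul, smul_add, smul_add,
        smul_add, smul_add, ← h1, pow_succ u, Module.End.mul_apply, h4, pow_add,
        mul_smul (x ^ (p * k - n)), Nat.sub_sub]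
      simp only [← mul_smul (_ : B) (_ : B), mul_comm (evalB p q n k), add_assoc]
  -- Shift of index: the term `k = 0` contains `(0)_q`, and the new top term contains `B_{n+1,n}`;
  -- both vanish.
  have hs : ∑ k ∈ Finset.range (n + 1),
      (qInt q (p * k - n) * evalB p q n k) • x ^ (p * k - (n + 1)) • (u ^ k) m
      = ∑ k ∈ Finset.range (n + 1), (qInt q (p * (k + 1) - n) * evalB p q n (k + 1)) •
        x ^ (p * (k + 1) - (n + 1)) • (u ^ (k + 1)) m := by
    have h := Finset.sum_range_succ' (fun k => (qInt q (p * k - n) * evalB p q n k) •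
      x ^ (p * k - (n + 1)) • (u ^ k) m) (n + 1)
    rw [Finset.sum_range_succ, evalB_eq_zero_of_lt (Nat.lt_succ_self n)] at h
    simpa using h
  rw [aeval_Phi_apply hp, map_sum, Finset.sum_congr rfl fun k _ => hT k, Finset.sum_add_distrib,
    Finset.sum_add_distrib, hs, ← Finset.sum_add_distrib, aeval_Phi_apply hp, aeval_Phi_apply hp,
    Finset.sum_range_succ' _ (n + 1), evalB_succ_zero, zero_smul, add_zero, Finset.smul_sum]
  congr 1
  refine Finset.sum_congr rfl fun k _ => ?_
  rw [evalB_succ_succ, add_smul]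

/-- A noncommutative binomial formula: by `map_aeval_Phi`, applying `D` either raises the index of
`Φ` or adds a `∇` with weight `q⁻ᵏ`, which is the Pascal rule in base `q⁻¹`. -/
lemma iterate_eq_sum_aeval_Phi (hp : 0 < p) (hq : qInt q p = 0)
    (hD : ∀ m, D (x • m) = m + q • x • D m)
    {u : Module.End A M} (hu : ∀ m, D (u m) = u (D m)) (n : ℕ) (m : M) :
    D^[n] m = ∑ k ∈ Finset.range (n + 1), qBinom (q ^ (p - 1)) n k •
      aeval u (Phi p q x k) ((nabla p x D u)^[n - k] m) := by
  induction n with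
  | zero => simp [aeval_Phi_zero_apply hp]
  | succ n ih =>
    have hs : ∑ k ∈ Finset.range (n + 1), (q ^ (p - 1)) ^ k • qBinom (q ^ (p - 1)) n k •
          aeval u (Phi p q x k) ((nabla p x D u)^[n + 1 - k] m)
        = (∑ k ∈ Finset.range (n + 1), (q ^ (p - 1)) ^ (k + 1) •
          qBinom (q ^ (p - 1)) n (k + 1) •
            aeval u (Phi p q x (k + 1)) ((nabla p x D u)^[n - k] m))
          + aeval u (Phi p q x 0) ((nabla p x D u)^[n + 1] m) := by
      have h := Finset.sum_range_succ' (fun k => (q ^ (p - 1)) ^ k • qBinom (q ^ (p - 1)) n k •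
          aeval u (Phi p q x k) ((nabla p x D u)^[n + 1 - k] m)) (n + 1)
      rw [Finset.sum_range_succ, qBinom_eq_zero _ n (n + 1) (by omega)] at h
      simpa only [zero_smul, smul_zero, add_zero, pow_zero, one_smul, qBinom_zero_right,
        Nat.sub_zero, Nat.add_sub_add_right] using h
    rw [Function.iterate_succ_apply', ih, map_sum, Finset.sum_range_succ' _ (n + 1),
      Nat.sub_zero, qBinom_zero_right, one_smul]
    have h1 : ∀ k ∈ Finset.range (n + 1), D (qBinom (q ^ (p - 1)) n k •
          aeval u (Phi p q x k) ((nabla p x D u)^[n - k] m))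
        = qBinom (q ^ (p - 1)) n k • aeval u (Phi p q x (k + 1)) ((nabla p x D u)^[n - k] m)
          + (q ^ (p - 1)) ^ k • qBinom (q ^ (p - 1)) n k •
            aeval u (Phi p q x k) ((nabla p x D u)^[n + 1 - k] m) := by
      intro k hk
      rw [Finset.mem_range] at hk
      rw [map_smul, map_aeval_Phi hp hq hD hu, smul_add, ← Function.iterate_succ_apply' (nabla p x D u),
        show n + 1 - k = (n - k).succ by omega, smul_comm (qBinom (q ^ (p - 1)) n k)]
    rw [Finset.sum_congr rfl h1, Finset.sum_add_distrib, hs, ← add_assoc,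
      ← Finset.sum_add_distrib]
    congr 1
    refine Finset.sum_congr rfl fun k _ => ?_
    rw [Nat.add_sub_add_right, qBinom_succ_succ, add_smul, mul_smul]

/-- The `p`-curvature of `∂` is the sum of `Φ(∂ ^ p)(u)` and the `p`-curvature of
`∂ - x ^ (p - 1) u`. -/
lemma iterate_prime_eq (hp : 0 < p) (hq : qInt q p = 0)
    (hqu : ∀ m, 0 < m → m < p → IsUnit (qInt q m)) (hD : ∀ m, D (x • m) = m + q • x • D m)
    {u : Module.End A M} (hu : ∀ m, D (u m) = u (D m)) (m : M) :
    D^[p] m = aeval u (Phi p q x p) m + (nabla p x D u)^[p] m := by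
  obtain ⟨n, rfl⟩ : ∃ n, p = n + 1 := ⟨p - 1, by omega⟩
  rw [iterate_eq_sum_aeval_Phi hp hq hD hu, Finset.sum_range_succ, Finset.sum_range_succ',
    Finset.sum_eq_zero, qBinom_self, Nat.sub_self, aeval_Phi_zero_apply hp]
  · simp [add_comm]
  · intro k hk
    rw [Finset.mem_range] at hk
    rw [qBinom_inv_eq_zero hp hq hqu (by omega) (by omega), zero_smul]

lemma iterate_eq_of_nabla_eq_zero (hp : 0 < p) (hq : qInt q p = 0)
    (hD : ∀ m, D (x • m) = m + q • x • D m)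
    {u : Module.End A M} (hu : ∀ m, D (u m) = u (D m)) {m : M} (hm : nabla p x D u m = 0) (n : ℕ) :
    D^[n] m = aeval u (Phi p q x n) m := by
  rw [iterate_eq_sum_aeval_Phi hp hq hD hu, Finset.sum_range_succ, Finset.sum_eq_zero]
  · simp
  · intro k hk
    rw [Finset.mem_range] at hk
    rw [show n - k = (n - k - 1) + 1 by omega, Function.iterate_succ_apply, hm, iterate_map_zero,
      map_zero, smul_zero]

/-- The sections of the Higgs module are the zeros of `∂ - x ^ (p - 1) u`. -/
lemma forall_iterate_eq_iff (hp : 0 < p) (hq : qInt q p = 0)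
    (hD : ∀ m, D (x • m) = m + q • x • D m)
    {u : Module.End A M} (hu : ∀ m, D (u m) = u (D m)) (m : M) :
    (∀ n : ℕ, aeval u (Phi p q x n) m = D^[n] m) ↔ nabla p x D u m = 0 := by
  refine ⟨fun h => ?_, fun h n => (iterate_eq_of_nabla_eq_zero hp hq hD hu h n).symm⟩
  have h1 := h 1
  rw [aeval_Phi_one_apply hp] at h1
  rw [nabla_apply, h1, Function.iterate_one, sub_self]

end Twisted

/-! ### Linearity over `A` and the operator `u` -/

section Generated

variable {B A : Type u} [CommRing B] [CommRing A] [Algebra B A] {p : ℕ} {q y : B} {x : A}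
  {M : Type u} [AddCommGroup M] [Module A M] [Module B M] [IsScalarTower B A M]
  {N : Type u} [AddCommGroup N] [Module A N] [Module B N] [IsScalarTower B A N]

/-- The powers `1, x, …, x ^ (p - 1)` span `A` over `B`. -/
def PowersSpan (p : ℕ) (B : Type u) {A : Type u} [CommRing B] [CommRing A] [Algebra B A] (x : A) :
    Prop :=
  ∀ a : A, ∃ c : Fin p → B, a = ∑ i, algebraMap B A (c i) * x ^ (i : ℕ)

lemma PowersSpan.map_smul_eq (hx : PowersSpan p B x) {f : M →ₗ[B] N}
    (hf : ∀ m, f (x • m) = x • f m) (a : A) (m : M) : f (a • m) = a • f m := by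
  have hpow : ∀ (n : ℕ) m, f (x ^ n • m) = x ^ n • f m := by
    intro n
    induction n with
    | zero => simp
    | succ n ih => intro m; rw [pow_succ, mul_smul, ih, hf, mul_smul]
  obtain ⟨c, rfl⟩ := hx a
  simp [Finset.sum_smul, mul_smul, hpow]

lemma PowersSpan.leibniz (hx : PowersSpan p B x) {σ : A →ₐ[B] A} {d : A →ₗ[B] A}
    {D : M →ₗ[B] M} (hσ : σ x = q • x) (hd : ∀ n : ℕ, d (x ^ n) = qInt q n • x ^ (n - 1))
    (hD : ∀ m, D (x • m) = m + q • x • D m) (a : A) (m : M) :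
    D (a • m) = d a • m + σ a • D m := by
  obtain ⟨c, rfl⟩ := hx a
  simp only [← Algebra.smul_def, map_sum, map_smul, map_pow, hσ, hd, _root_.smul_pow, Finset.sum_smul,
    smul_assoc, map_pow_smul_of_map_smul hD, smul_add, Finset.sum_add_distrib]

lemma map_pow_eq {d : A →ₗ[B] A} (hd : ∀ a, d (x * a) = a + q • (x * d a)) (h1 : d 1 = 0) (n : ℕ) :
    d (x ^ n) = qInt q n • x ^ (n - 1) := by
  have h := map_pow_smul_of_map_smul (M := A) (D := d) (x := x) hd n 1
  simpa [h1] using h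

variable {D : M →ₗ[B] M}

/-- In `D ^ p (x m) = (p)_q D ^ (p - 1) m + q ^ p x D ^ p m` the first term vanishes and `q ^ p =
1`. Hence `D ^ p` commutes with `x`. -/
lemma iterate_prime_smul (hx : PowersSpan p B x) (hq : qInt q p = 0)
    (hD : ∀ m, D (x • m) = m + q • x • D m) (a : A) (m : M) :
    (D ^ p) (a • m) = a • (D ^ p) m := by
  refine hx.map_smul_eq (f := D ^ p) (fun m => ?_) a m
  rw [Module.End.pow_apply, Module.End.pow_apply, iterate_map_smul hD, hq,
    pow_eq_one_of_qInt_eq_zero hq, zero_smul, zero_add, one_smul]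

/-- `Φ(∂ ^ p)` is `c θ + θ ^ 2 r(θ)` with `c = B_{1, p}(q)`, and its coefficients come from `B`. -/
noncomputable def phiTail (p : ℕ) (q y : B) : B[X] :=
  ∑ k ∈ Finset.range (p - 1), C (evalB p q p (k + 2) * y ^ (k + 1)) * X ^ k

/-- For `n = p` every surviving exponent `p k - p` is a multiple of `p`, so the powers of `x` are
powers of `y`; the equation for `u` can then be solved over `B`. -/
lemma aeval_Phi_prime_apply (hp : 2 ≤ p) (hy : algebraMap B A y = x ^ p) (u : Module.End A M)
    (m : M) : aeval u (Phi p q x p) m =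
      aeval (u.restrictScalars B : Module.End B M)
        (C (evalB p q p 1) * X + X ^ 2 * phiTail p q y) m := by
  have hup : ∀ k m, ((u.restrictScalars B : Module.End B M) ^ k) m = (u ^ k) m := fun k m => by
    rw [Module.End.pow_apply, Module.End.pow_apply]; rfl
  obtain ⟨n, rfl⟩ : ∃ n, p = n + 2 := ⟨p - 2, by omega⟩
  rw [aeval_Phi_apply (by omega), Finset.sum_range_succ', Finset.sum_range_succ', evalB_succ_zero,
    zero_smul, add_zero, add_comm, phiTail, Finset.mul_sum, map_add, map_sum, LinearMap.add_apply,
    LinearMap.sum_apply]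
  congr 1
  · simp
  · refine Finset.sum_congr rfl fun k _ => ?_
    have h : (n + 2) * (k + 1 + 1) - (n + 2) = (n + 2) * (k + 1) := by
      rw [Nat.mul_succ]; omega
    rw [h, mul_left_comm, ← pow_add, add_comm 2 k, pow_mul, ← hy, ← map_pow, algebraMap_smul,
      ← mul_smul, map_mul, aeval_C, map_pow, aeval_X, Module.End.mul_apply,
      Module.algebraMap_end_apply, hup]

lemma quasiNilpotent_pow (hp : 0 < p) (hn : QuasiNilpotent D) : QuasiNilpotent (D ^ p) := by
  intro m
  obtain ⟨n, hm⟩ := hn m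
  refine ⟨n, ?_⟩
  rw [← Module.End.pow_apply, ← pow_mul, Module.End.pow_apply]
  exact iterate_eq_zero_of_le (D := D.toAddMonoidHom) (Nat.le_mul_of_pos_left n hp) hm

variable (p q y) in
/-- The quasi-nilpotent operator `u` with `Φ(∂ ^ p)(u) = ∂ ^ p`. -/
noncomputable def higgsOp (D : M →ₗ[B] M) (hP : QuasiNilpotent (D ^ p)) : Module.End B M :=
  evalCompInv (Ring.inverse (evalB p q p 1)) (phiTail p q y) (D ^ p) hP

lemma map_higgsOp {D' : N →ₗ[B] N} (hP : QuasiNilpotent (D ^ p)) (hP' : QuasiNilpotent (D' ^ p))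
    {f : M →ₗ[B] N} (hf : ∀ m, f (D m) = D' (f m)) (m : M) :
    f (higgsOp p q y D hP m) = higgsOp p q y D' hP' (f m) := by
  refine map_evalCompInv hP hP' f (fun m => ?_) m
  rw [Module.End.pow_apply, Module.End.pow_apply]
  exact (Function.Semiconj.iterate_right (f := f) (ga := D) (gb := D') hf p) m

lemma map_higgsOp_self (hP : QuasiNilpotent (D ^ p)) (m : M) :
    D (higgsOp p q y D hP m) = higgsOp p q y D hP (D m) :=
  map_higgsOp hP hP (fun _ => rfl) m

lemma higgsOp_smul (hx : PowersSpan p B x) (hq : qInt q p = 0)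
    (hD : ∀ m, D (x • m) = m + q • x • D m) (hP : QuasiNilpotent (D ^ p)) (a : A) (m : M) :
    higgsOp p q y D hP (a • m) = a • higgsOp p q y D hP m :=
  (map_evalCompInv hP hP (Algebra.lsmul B B M a)
    -- Multiplication by `a` commutes with `D ^ p`, hence with the operator built from it; this is
    -- how the `B`-linear solution becomes `A`-linear.
    (fun m => (iterate_prime_smul hx hq hD a m).symm) m).symm

lemma isUnit_evalB_prime_one (hp : 0 < p) (hqu : ∀ m, 0 < m → m < p → IsUnit (qInt q m)) :
    IsUnit (evalB p q p 1) := by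
  obtain ⟨n, rfl⟩ : ∃ n, p = n + 1 := ⟨p - 1, by omega⟩
  exact isUnit_evalB_one hqu (by omega)

variable (hp : 2 ≤ p) (hqu : ∀ m, 0 < m → m < p → IsUnit (qInt q m))
include hp hqu

/-- Existence and uniqueness of the quasi-nilpotent solution of `Φ(∂ ^ p)(u) = ∂ ^ p`. -/
lemma isHiggs_iff (hy : algebraMap B A y = x ^ p) (hP : QuasiNilpotent (D ^ p))
    (u : Module.End A M) :
    (QuasiNilpotent u ∧ ∀ m, aeval u (Phi p q x p) m = D^[p] m) ↔
      ∀ m, u m = higgsOp p q y D hP m := by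
  have hc := Ring.mul_inverse_cancel _ (isUnit_evalB_prime_one (by omega) hqu)
  constructor
  · rintro ⟨hu, h⟩ m
    have h1 : aeval (u.restrictScalars B : Module.End B M)
        (C (evalB p q p 1) * X + X ^ 2 * phiTail p q y) = D ^ p := by
      ext m
      rw [← aeval_Phi_prime_apply hp hy, h, Module.End.pow_apply]
    exact LinearMap.congr_fun (eq_evalCompInv hc hP (v := u.restrictScalars B) hu h1) m
  · intro h
    have h1 : (u.restrictScalars B : Module.End B M) = higgsOp p q y D hP := LinearMap.ext h
    have h2 : QuasiNilpotent (u.restrictScalars B : Module.End B M) := by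
      rw [h1]; exact quasiNilpotent_evalCompInv hP
    refine ⟨h2, fun m => ?_⟩
    rw [aeval_Phi_prime_apply hp hy, h1, higgsOp, aeval_evalCompInv hc, Module.End.pow_apply]

end Generated

/-! ### Descent along `∂ - x ^ (p - 1) u` -/

section Nilpotent

variable {B M : Type*} [CommRing B] [AddCommGroup M] [Module B M]

lemma bijective_one_sub_of_quasiNilpotent {w : Module.End B M} (hw : QuasiNilpotent w) :
    Function.Bijective (1 - w : Module.End B M) := by
  constructor
  · rw [injective_iff_map_eq_zero]
    intro m hm
    have h : w m = m := (sub_eq_zero.mp hm).symm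
    obtain ⟨n, hn⟩ := hw m
    rwa [Function.iterate_fixed h] at hn
  · intro m
    obtain ⟨n, hn⟩ := hw m
    refine ⟨(∑ i ∈ Finset.range n, w ^ i) m, ?_⟩
    rw [← Module.End.mul_apply, mul_neg_geom_sum, LinearMap.sub_apply, Module.End.pow_apply, hn,
      sub_zero, Module.End.one_apply]

lemma QuasiNilpotent.smul {w : Module.End B M} (hw : QuasiNilpotent w) (b : B) :
    QuasiNilpotent (b • w) := by
  intro m
  obtain ⟨n, hn⟩ := hw m
  exact ⟨n, by rw [← Module.End.pow_apply, _root_.smul_pow, LinearMap.smul_apply, Module.End.pow_apply,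
    hn, smul_zero]⟩

end Nilpotent

section Descent

variable {B A M : Type u} [CommRing B] [CommRing A] [Algebra B A] [AddCommGroup M] [Module A M]
  [Module B M] [IsScalarTower B A M] {p : ℕ} {q y : B} {x : A} {D : M →ₗ[B] M}

variable (q y) in
/-- The automorphism `1 + (q - 1) x ^ p u`, in terms of `y = x ^ p`. -/
def gauge (u : Module.End A M) : Module.End B M := 1 - ((1 - q) * y) • u.restrictScalars B

variable {u : Module.End A M}

lemma gauge_apply (m : M) :
    gauge q y u m = m - ((1 - q) * y) • u m := rfl

lemma bijective_gauge (hn : QuasiNilpotent u) : Function.Bijective (gauge q y u) :=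
  bijective_one_sub_of_quasiNilpotent
    (QuasiNilpotent.smul (w := u.restrictScalars B) hn ((1 - q) * y))

/-- Here `D (x ^ (n+1) h)` contributes `q ^ (n+1) y x ^ n u h`, and subtracting `x ^ (p - 1) u (x ^
(n+1) h) = y x ^ n u h` leaves the factor `q ^ (n+1) - 1 = -(1 - q) (n+1)_q`. This accounts for the
shape of `gauge`. -/
lemma nabla_pow_smul (hp : 0 < p) (hy : algebraMap B A y = x ^ p)
    (hD : ∀ m, D (x • m) = m + q • x • D m) {h : M} (hh : nabla p x D u h = 0) (n : ℕ) :
    nabla p x D u (x ^ (n + 1) • h) = qInt q (n + 1) • x ^ n • gauge q y u h := by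
  have hDh : D h = x ^ (p - 1) • u h := sub_eq_zero.mp hh
  have h1 : x ^ (n + 1) • x ^ (p - 1) • u h = y • x ^ n • u h := by
    rw [← algebraMap_smul A y, hy, ← mul_smul, ← mul_smul, ← pow_add, ← pow_add]
    congr 2
    omega
  have h2 : q ^ (n + 1) • y • x ^ n • u h - y • x ^ n • u h
      = -(qInt q (n + 1) • ((1 - q) * y) • x ^ n • u h) := by
    rw [← mul_smul, ← mul_smul, ← sub_smul, ← neg_smul]
    congr 1
    linear_combination -y * sub_one_mul_qInt q (n + 1)
  rw [nabla_apply, map_pow_smul_of_map_smul hD, hDh, map_smul, smul_comm (x ^ (p - 1)), h1,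
    add_sub_assoc, h2, ← sub_eq_add_neg, Nat.add_sub_cancel, gauge_apply, smul_sub, smul_sub,
    smul_comm (x ^ n) ((1 - q) * y)]

lemma map_gauge {f : M →ₗ[B] M} (hf : ∀ m, f (u m) = u (f m)) (m : M) :
    f (gauge q y u m) = gauge q y u (f m) := by
  rw [gauge_apply, gauge_apply, map_sub, map_smul, hf]

lemma nabla_map (hu : ∀ m, D (u m) = u (D m)) (m : M) :
    nabla p x D u (u m) = u (nabla p x D u m) := by
  rw [nabla_apply, nabla_apply, map_sub, map_smul, hu]

lemma nabla_gauge_eq_zero (hu : ∀ m, D (u m) = u (D m)) {m : M} (hm : nabla p x D u m = 0) :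
    nabla p x D u (gauge q y u m) = 0 := by
  rw [map_gauge (nabla_map hu), hm, map_zero]

lemma nabla_pow_pow_smul (hp : 0 < p) (hy : algebraMap B A y = x ^ p)
    (hD : ∀ m, D (x • m) = m + q • x • D m) (hu : ∀ m, D (u m) = u (D m)) (n : ℕ) {h : M}
    (hh : nabla p x D u h = 0) :
    (nabla p x D u ^ n) (x ^ n • h) = qFact q n • (gauge q y u ^ n) h := by
  induction n generalizing h with
  | zero => simp [qFact]
  | succ n ih =>
    rw [pow_succ, Module.End.mul_apply, nabla_pow_smul hp hy hD hh, map_smul,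
      ih (nabla_gauge_eq_zero hu hh), pow_succ, Module.End.mul_apply, qFact_succ, ← mul_smul,
      mul_comm]

lemma nabla_pow_gauge_eq_zero (hu : ∀ m, D (u m) = u (D m)) (n : ℕ) {m : M}
    (hm : nabla p x D u m = 0) : nabla p x D u ((gauge q y u ^ n) m) = 0 := by
  induction n with
  | zero => simpa
  | succ n ih => rw [pow_succ', Module.End.mul_apply]; exact nabla_gauge_eq_zero hu ih

lemma nabla_pow_pow_smul_eq_zero (hp : 0 < p) (hy : algebraMap B A y = x ^ p)
    (hD : ∀ m, D (x • m) = m + q • x • D m) (hu : ∀ m, D (u m) = u (D m)) {i n : ℕ} (hin : i < n)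
    {h : M} (hh : nabla p x D u h = 0) : (nabla p x D u ^ n) (x ^ i • h) = 0 := by
  obtain ⟨k, rfl⟩ : ∃ k, n = k + 1 + i := ⟨n - i - 1, by omega⟩
  rw [pow_add, Module.End.mul_apply, nabla_pow_pow_smul hp hy hD hu i hh, pow_succ,
    Module.End.mul_apply, map_smul, nabla_pow_gauge_eq_zero hu i hh, smul_zero, map_zero]

/-- The automorphism `gauge` commutes with `∇`, so by injectivity the preimage of an element of `ker
∇` is again in `ker ∇`. -/
lemma exists_gauge_pow_eq (hn : QuasiNilpotent u) (hu : ∀ m, D (u m) = u (D m)) (n : ℕ) {k : M}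
    (hk : nabla p x D u k = 0) : ∃ h, nabla p x D u h = 0 ∧ (gauge q y u ^ n) h = k := by
  induction n generalizing k with
  | zero => exact ⟨k, hk, rfl⟩
  | succ n ih =>
    obtain ⟨h, rfl⟩ := (bijective_gauge (q := q) (y := y) hn).2 k
    rw [map_gauge (nabla_map hu)] at hk
    obtain ⟨h', h1, h2⟩ := ih
      ((bijective_gauge (q := q) (y := y) hn).1 (hk.trans (map_zero (gauge q y u)).symm))
    exact ⟨h', h1, by rw [pow_succ', Module.End.mul_apply, h2]⟩

/-- The sum of the translates `x ^ i H`, `i < p`, of the kernel `H` of `∂ - x ^ (p - 1) u` is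
direct. -/
lemma eq_zero_of_sum_pow_smul_eq_zero (hp : 0 < p) (hy : algebraMap B A y = x ^ p)
    (hqu : ∀ m, 0 < m → m < p → IsUnit (qInt q m)) (hn : QuasiNilpotent u)
    (hD : ∀ m, D (x • m) = m + q • x • D m) (hu : ∀ m, D (u m) = u (D m)) {r : ℕ} (hr : r ≤ p)
    {h : ℕ → M} (hh : ∀ i, nabla p x D u (h i) = 0)
    (h0 : ∑ i ∈ Finset.range r, x ^ i • h i = 0) : ∀ i < r, h i = 0 := by
  induction r with
  | zero => intro i hi; omega
  | succ r ih =>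
    -- Applying `∇ ^ r` kills the terms of index `i < r` and sends the last one to `(r)_q ! gauge ^
    -- r (h r)`, from which `h r = 0`.
    have h1 := congrArg (nabla p x D u ^ r) h0
    rw [map_zero, Finset.sum_range_succ, map_add, map_sum, Finset.sum_eq_zero, zero_add,
      nabla_pow_pow_smul hp hy hD hu r (hh r), (isUnit_qFact hqu hr).smul_eq_zero,
      Module.End.pow_apply] at h1
    · have h2 : h r = 0 := by
        refine (bijective_gauge (q := q) (y := y) hn).1.iterate r (h1.trans ?_)
        rw [← Module.End.pow_apply, map_zero]
      rw [Finset.sum_range_succ, h2, smul_zero, add_zero] at h0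
      intro i hi
      rcases Nat.lt_succ_iff_lt_or_eq.mp hi with hi | rfl
      · exact ih (by omega) h0 i hi
      · exact h2
    · intro i hi
      exact nabla_pow_pow_smul_eq_zero hp hy hD hu (Finset.mem_range.mp hi) (hh i)

/-- The translates `x ^ i H`, `i < r`, of the kernel `H` of `∂ - x ^ (p - 1) u` span the kernel of
its `r`-th power. -/
lemma exists_sum_pow_smul_eq (hp : 0 < p) (hy : algebraMap B A y = x ^ p)
    (hqu : ∀ m, 0 < m → m < p → IsUnit (qInt q m)) (hn : QuasiNilpotent u)
    (hD : ∀ m, D (x • m) = m + q • x • D m) (hu : ∀ m, D (u m) = u (D m)) {r : ℕ} (hr : r ≤ p)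
    (m : M) (hm : (nabla p x D u ^ r) m = 0) :
    ∃ h : ℕ → M, (∀ i, nabla p x D u (h i) = 0) ∧ ∑ i ∈ Finset.range r, x ^ i • h i = m := by
  induction r generalizing m with
  | zero => exact ⟨0, fun i => by simp, by simpa using hm.symm⟩
  | succ r ih =>
    rw [pow_succ', Module.End.mul_apply] at hm
    obtain ⟨k, hk, hkm⟩ := exists_gauge_pow_eq (q := q) (y := y) hn hu r hm
    obtain ⟨c, hc⟩ := (isUnit_qFact hqu hr).exists_left_inv
    have hck : nabla p x D u (c • k) = 0 := by rw [map_smul, hk, smul_zero]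
    -- With `c` the inverse of `(r)_q !`, the element `x ^ r c k` has the same image under `∇ ^ r`
    -- as `m`, so the difference falls under the induction hypothesis.
    obtain ⟨h, hh, hs⟩ := ih (by omega) (m - x ^ r • c • k) (by
      rw [map_sub, nabla_pow_pow_smul hp hy hD hu r hck, map_smul, hkm, ← mul_smul, mul_comm, hc,
        one_smul, sub_self])
    refine ⟨Function.update h r (c • k), fun i => ?_, ?_⟩
    · rcases eq_or_ne i r with rfl | hi
      · rw [Function.update_self, hck]
      · rw [Function.update_of_ne hi, hh]
    · rw [Finset.sum_range_succ, Function.update_self, ← eq_sub_iff_add_eq, ← hs]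
      refine Finset.sum_congr rfl fun i hi => ?_
      rw [Function.update_of_ne (Finset.mem_range.mp hi).ne]

end Descent

/-! ### The twisted derivation of `A` -/

section Derivation

variable {B A : Type u} [CommRing B] [CommRing A] [Algebra B A] {p : ℕ} {q y : B} {x : A}

/-- The powers `1, x, …, x ^ (p - 1)` form a basis of `A` over `B`. -/
lemma exists_basis_pow
    (hbasis : ∀ a : A, ∃! c : Fin p → B, a = ∑ i, algebraMap B A (c i) * x ^ (i : ℕ)) :
    ∃ b : Module.Basis (Fin p) B A, ∀ i, b i = x ^ (i : ℕ) := by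
  have hl : ∀ c : Fin p → B, Fintype.linearCombination B (fun i : Fin p => x ^ (i : ℕ)) c
      = ∑ i, algebraMap B A (c i) * x ^ (i : ℕ) := fun c => by
    simp [Fintype.linearCombination_apply, Algebra.smul_def]
  have hbij : Function.Bijective (Fintype.linearCombination B (fun i : Fin p => x ^ (i : ℕ))) := by
    constructor
    · intro c c' h
      rw [hl, hl] at h
      exact (hbasis _).unique rfl h
    · intro a
      obtain ⟨c, hc, -⟩ := hbasis a
      exact ⟨c, by rw [hl]; exact hc.symm⟩
  refine ⟨Module.Basis.ofEquivFun (LinearEquiv.ofBijective _ hbij).symm, fun i => ?_⟩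
  rw [Module.Basis.coe_ofEquivFun, LinearEquiv.symm_symm]
  beta_reduce
  rw [LinearEquiv.ofBijective_apply,
    Fintype.linearCombination_apply_single, one_smul]

lemma exists_twisted_derivation (hq : qInt q p = 0) (hy : algebraMap B A y = x ^ p)
    (hx : PowersSpan p B x) (b : Module.Basis (Fin p) B A) (hb : ∀ i, b i = x ^ (i : ℕ)) :
    ∃ d : A →ₗ[B] A, d 1 = 0 ∧ ∀ a, d (x * a) = a + q • (x * d a) := by
  -- For `p = 0` the empty family spans `A`, so `A` is zero.
  rcases Nat.eq_zero_or_pos p with rfl | hp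
  · have : ∀ a : A, a = 0 := fun a => by obtain ⟨c, hc⟩ := hx a; simpa using hc
    exact ⟨0, rfl, fun a => by rw [this a]; simp⟩
  set d : A →ₗ[B] A := b.constr B (fun i : Fin p => qInt q (i : ℕ) • x ^ ((i : ℕ) - 1)) with hd
  have h1 : ∀ i < p, d (x ^ i) = qInt q i • x ^ (i - 1) := by
    intro i hi
    have h := b.constr_basis B (fun i : Fin p => qInt q (i : ℕ) • x ^ ((i : ℕ) - 1)) ⟨i, hi⟩
    rwa [hb] at h
  refine ⟨d, by simpa using h1 0 hp, fun a => ?_⟩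
  have h2 : d ∘ₗ LinearMap.mulLeft B x = LinearMap.id + q • LinearMap.mulLeft B x ∘ₗ d := by
    refine b.ext fun i => ?_
    rw [hb]
    simp only [LinearMap.comp_apply, LinearMap.mulLeft_apply, LinearMap.add_apply,
      LinearMap.id_apply, LinearMap.smul_apply, h1 i i.2, ← pow_succ']
    have h3 : (x ^ (i : ℕ) + q • (x * qInt q (i : ℕ) • x ^ ((i : ℕ) - 1)))
        = qInt q ((i : ℕ) + 1) • x ^ (i : ℕ) := by
      rw [qInt_succ, add_smul, one_smul, mul_smul, mul_smul_comm]
      rcases Nat.eq_zero_or_pos (i : ℕ) with h | h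
      · simp [h]
      · rw [← pow_succ', Nat.sub_add_cancel h]
    rw [h3]
    rcases Nat.lt_or_ge ((i : ℕ) + 1) p with h | h
    · rw [h1 _ h, Nat.add_sub_cancel]
    -- The wrap-around case: `x ^ p = y` is a scalar, which `d` kills, consistently with `(p)_q =
    -- 0`.
    · rw [show (i : ℕ) + 1 = p by omega, hq, zero_smul, ← hy, Algebra.algebraMap_eq_smul_one,
        map_smul, ← pow_zero x, h1 0 hp, qInt_zero, zero_smul, smul_zero]
  exact LinearMap.congr_fun h2 a

lemma PowersSpan.ext_of_map_mul (hx : PowersSpan p B x) {d d' : A →ₗ[B] A}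
    (h1 : d 1 = 0) (hd : ∀ a, d (x * a) = a + q • (x * d a))
    (h1' : d' 1 = 0) (hd' : ∀ a, d' (x * a) = a + q • (x * d' a)) : d = d' := by
  ext a
  obtain ⟨c, rfl⟩ := hx a
  simp only [← Algebra.smul_def, map_sum, map_smul, map_pow_eq hd h1, map_pow_eq hd' h1']

lemma iterate_prime_self (hx : PowersSpan p B x) (hq : qInt q p = 0) {d : A →ₗ[B] A}
    (h1 : d 1 = 0) (hd : ∀ a, d (x * a) = a + q • (x * d a)) (hp : 0 < p) (a : A) :
    d^[p] a = 0 := by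
  have h := iterate_prime_smul (D := d) (x := x) hx hq hd a 1
  rw [Module.End.pow_apply, Module.End.pow_apply, smul_eq_mul, mul_one,
    ← Nat.sub_add_cancel hp, Function.iterate_succ_apply d _ 1, h1, iterate_map_zero,
    smul_zero] at h
  rwa [← Nat.sub_add_cancel hp]

end Derivation

/-! ### The module `A ⊗ H` -/

section BaseChange

variable {B A : Type u} [CommRing B] [CommRing A] [Algebra B A] {p : ℕ} {q y : B} {x : A}
  {H : Type u} [AddCommGroup H] [Module B H]

lemma PowersSpan.exists_sum_tmul (hx : PowersSpan p B x) (t : A ⊗[B] H) :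
    ∃ h : ℕ → H, t = ∑ i ∈ Finset.range p, (x ^ i) • (1 : A) ⊗ₜ[B] h i := by
  induction t using TensorProduct.induction_on with
  | zero => exact ⟨0, by simp⟩
  | tmul a h =>
    obtain ⟨c, rfl⟩ := hx a
    refine ⟨fun i => if hi : i < p then c ⟨i, hi⟩ • h else 0, ?_⟩
    rw [Finset.sum_range, TensorProduct.sum_tmul]
    refine Finset.sum_congr rfl fun i _ => ?_
    beta_reduce
    rw [dif_pos i.2, TensorProduct.smul_tmul', ← Algebra.smul_def, TensorProduct.smul_tmul,
      smul_eq_mul, mul_one]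
  | add s t hs ht =>
    obtain ⟨h, rfl⟩ := hs
    obtain ⟨h', rfl⟩ := ht
    exact ⟨h + h', by simp [TensorProduct.tmul_add, Finset.sum_add_distrib]⟩

variable (p x) in
/-- The twisted derivation of `A ⊗ H` with `∂ (1 ⊗ h) = x ^ (p - 1) ⊗ u h`. -/
noncomputable def tensorDer (σ : A →ₐ[B] A) (d : A →ₗ[B] A) (u : Module.End B H) :
    A ⊗[B] H →ₗ[B] A ⊗[B] H :=
  TensorProduct.map d LinearMap.id + TensorProduct.map (x ^ (p - 1) • σ.toLinearMap) u

variable {σ : A →ₐ[B] A} {d : A →ₗ[B] A} {u : Module.End B H}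

lemma tensorDer_tmul (a : A) (h : H) : tensorDer p x σ d u (a ⊗ₜ h)
    = d a ⊗ₜ h + (x ^ (p - 1) * σ a) ⊗ₜ u h := rfl

lemma tensorDer_smul (hd : ∀ a b, d (a * b) = d a * b + σ a * d b) (a : A) (t : A ⊗[B] H) :
    tensorDer p x σ d u (a • t) = d a • t + σ a • tensorDer p x σ d u t := by
  induction t using TensorProduct.induction_on with
  | zero => simp
  | tmul b h =>
    simp only [TensorProduct.smul_tmul', tensorDer_tmul, smul_eq_mul, hd, map_mul, smul_add,
      TensorProduct.add_tmul, mul_left_comm, add_assoc]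
  | add s t hs ht => simp only [smul_add, map_add, hs, ht]; abel

lemma tensorDer_one_tmul (h1 : d 1 = 0) (h : H) :
    tensorDer p x σ d u (1 ⊗ₜ h) = (x ^ (p - 1) : A) ⊗ₜ[B] u h := by
  rw [tensorDer_tmul, h1, TensorProduct.zero_tmul, zero_add, map_one, mul_one]

lemma baseChange_pow_tmul (n : ℕ) (a : A) (h : H) :
    (u.baseChange A ^ n) (a ⊗ₜ h) = a ⊗ₜ (u ^ n) h := by
  induction n with
  | zero => rfl
  | succ n ih => rw [pow_succ', Module.End.mul_apply, ih, LinearMap.baseChange_tmul, pow_succ',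
      Module.End.mul_apply]

lemma tensorDer_baseChange (t : A ⊗[B] H) :
    tensorDer p x σ d u (u.baseChange A t) = u.baseChange A (tensorDer p x σ d u t) := by
  induction t using TensorProduct.induction_on with
  | zero => simp
  | tmul b h => simp only [LinearMap.baseChange_tmul, tensorDer_tmul, map_add]
  | add s t hs ht => simp only [map_add, hs, ht]

lemma nabla_one_tmul (h1 : d 1 = 0) (h : H) :
    nabla p x (tensorDer p x σ d u) (u.baseChange A) (1 ⊗ₜ h) = 0 := by
  rw [nabla_apply, tensorDer_one_tmul h1, LinearMap.baseChange_tmul, TensorProduct.smul_tmul',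
    smul_eq_mul, mul_one, sub_self]

lemma quasiNilpotent_of_forall_tmul {D : A ⊗[B] H →+ A ⊗[B] H}
    (h : ∀ a h, ∃ n : ℕ, D^[n] (a ⊗ₜ h) = 0) : QuasiNilpotent D := by
  intro t
  induction t using TensorProduct.induction_on with
  | zero => exact ⟨0, rfl⟩
  | tmul a k => exact h a k
  | add s t hs ht =>
    obtain ⟨m, hm⟩ := hs
    obtain ⟨n, hn⟩ := ht
    refine ⟨max m n, ?_⟩
    rw [iterate_map_add, iterate_eq_zero_of_le (le_max_left m n) hm,
      iterate_eq_zero_of_le (le_max_right m n) hn, add_zero]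

lemma quasiNilpotent_baseChange (hu : QuasiNilpotent u) : QuasiNilpotent (u.baseChange A) := by
  refine quasiNilpotent_of_forall_tmul (D := (u.baseChange A).toAddMonoidHom) fun a h => ?_
  obtain ⟨n, hn⟩ := hu h
  refine ⟨n, ?_⟩
  change (u.baseChange A)^[n] _ = 0
  rw [← Module.End.pow_apply, baseChange_pow_tmul, Module.End.pow_apply, hn, TensorProduct.tmul_zero]

section

variable (hp : 2 ≤ p) (hq : qInt q p = 0) (hx : PowersSpan p B x)
  (hD : ∀ t : A ⊗[B] H, tensorDer p x σ d u (x • t) = t + q • x • tensorDer p x σ d u t)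
  (h1 : d 1 = 0)
include hp hq hx hD h1

/-- `D ^ (p n)` is `A`-linear, so it suffices to treat `1 ⊗ h`, where it equals `Φ_{pn}(u)`. Terms
with `k < n` vanish because `p k < p n`, the others because `u ^ n h = 0`. -/
lemma quasiNilpotent_tensorDer (hu : QuasiNilpotent u) : QuasiNilpotent (tensorDer p x σ d u) := by
  refine quasiNilpotent_of_forall_tmul (D := (tensorDer p x σ d u).toAddMonoidHom) fun a h => ?_
  obtain ⟨n, hn⟩ := hu h
  refine ⟨p * n, ?_⟩
  change (tensorDer p x σ d u)^[p * n] _ = 0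
  have hlin : ∀ (k : ℕ) (t : A ⊗[B] H), (⇑(tensorDer p x σ d u ^ p))^[k] (a • t)
      = a • (⇑(tensorDer p x σ d u ^ p))^[k] t := fun k t =>
    (Function.Semiconj.iterate_right (f := fun t => a • t) (ga := ⇑(tensorDer p x σ d u ^ p))
      (gb := ⇑(tensorDer p x σ d u ^ p)) (fun t => (iterate_prime_smul hx hq hD a t).symm) k t).symm
  have h2 : a ⊗ₜ[B] h = a • (1 ⊗ₜ[B] h) := by
    rw [TensorProduct.smul_tmul', smul_eq_mul, mul_one]
  rw [h2, Function.iterate_mul, ← Module.End.coe_pow, hlin, Module.End.coe_pow,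
    ← Function.iterate_mul,
    iterate_eq_of_nabla_eq_zero (by omega) hq hD tensorDer_baseChange (nabla_one_tmul h1 h),
    aeval_Phi_apply (by omega), Finset.sum_eq_zero, smul_zero]
  intro k _
  rcases Nat.lt_or_ge k n with hk | hk
  · rw [evalB_eq_zero_of_mul_lt (by omega) (Nat.mul_lt_mul_of_pos_left hk (by omega)), zero_smul]
  · obtain ⟨j, rfl⟩ := Nat.exists_eq_add_of_le' hk
    rw [baseChange_pow_tmul, pow_add, Module.End.mul_apply, Module.End.pow_apply u n, hn, map_zero,
      TensorProduct.tmul_zero, smul_zero, smul_zero]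

/-- Both sides are `A`-linear in `t`, and on `1 ⊗ h`, which `∇` kills, they agree. -/
lemma aeval_Phi_baseChange (t : A ⊗[B] H) :
    aeval (u.baseChange A) (Phi p q x p) t = (tensorDer p x σ d u)^[p] t := by
  induction t using TensorProduct.induction_on with
  | zero => rw [map_zero, iterate_map_zero]
  | tmul a h =>
    have h2 : a ⊗ₜ[B] h = a • (1 ⊗ₜ[B] h) := by
      rw [TensorProduct.smul_tmul', smul_eq_mul, mul_one]
    rw [h2, map_smul, ← Module.End.pow_apply, iterate_prime_smul hx hq hD, Module.End.pow_apply,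
      iterate_eq_of_nabla_eq_zero (by omega) hq hD tensorDer_baseChange (nabla_one_tmul h1 h)]
  | add s t hs ht => rw [map_add, hs, ht, iterate_map_add]

/-- The kernel of `∂ - x ^ (p - 1) u` on `A ⊗ H` is `1 ⊗ H`. -/
lemma nabla_eq_zero_iff (hqu : ∀ m, 0 < m → m < p → IsUnit (qInt q m))
    (hy : algebraMap B A y = x ^ p) (hu : QuasiNilpotent u) (t : A ⊗[B] H) :
    nabla p x (tensorDer p x σ d u) (u.baseChange A) t = 0 ↔ ∃ h, (1 : A) ⊗ₜ[B] h = t := by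
  refine ⟨fun ht => ?_, ?_⟩
  · obtain ⟨h, hh⟩ := hx.exists_sum_tmul t
    obtain ⟨n, rfl⟩ : ∃ n, p = n + 1 := ⟨p - 1, by omega⟩
    refine ⟨h 0, ?_⟩
    -- Directness is applied to `t = ∑ x ^ i (1 ⊗ h i)` compared with `t` itself as the term of
    -- index `0`.
    have h2 := eq_zero_of_sum_pow_smul_eq_zero (r := n + 1) (by omega) hy hqu
      (quasiNilpotent_baseChange (A := A) hu) hD tensorDer_baseChange le_rfl
      (h := fun i => 1 ⊗ₜ[B] h i - if i = 0 then t else 0) (fun i => by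
        rw [map_sub, nabla_one_tmul h1]
        split_ifs
        · rw [ht, sub_zero]
        · rw [map_zero, sub_zero]) (by
        simp only [smul_sub, Finset.sum_sub_distrib, ← hh]
        rw [Finset.sum_range_succ']
        simp) 0 (by omega)
    simpa [sub_eq_zero] using h2
  · rintro ⟨h, rfl⟩
    exact nabla_one_tmul h1 h

end

/-- The coordinate of `A` along `x ^ 0` induces a retraction `A ⊗ H → H`. -/
lemma one_tmul_injective (hp : 0 < p) (b : Module.Basis (Fin p) B A)
    (hb : ∀ i, b i = x ^ (i : ℕ)) : Function.Injective fun h : H => (1 : A) ⊗ₜ[B] h := by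
  intro h h' hh
  have h2 := congrArg (TensorProduct.lid B H ∘ (b.coord ⟨0, hp⟩).rTensor H) hh
  have h3 : b.repr 1 = Finsupp.single ⟨0, hp⟩ 1 := by
    rw [← b.repr_self, hb, pow_zero]
  simpa [h3] using h2

end BaseChange

/-! ### Isomorphisms in the two categories -/

/-- A linear equivalence that commutes with the `σ`-derivations is an isomorphism. -/
def SigmaModule.isoMk {R A : Type u} [CommRing R] [CommRing A] [Algebra R A] {σ : A →ₐ[R] A}
    {d : A →+ A} {M N : SigmaModule σ d} (e : M.carrier ≃ₗ[A] N.carrier)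
    (he : ∀ m, e (M.der m) = N.der (e m)) : M ≅ N where
  hom := ⟨e, he⟩
  inv := ⟨e.symm, fun n => by
    rw [LinearEquiv.coe_coe, LinearEquiv.symm_apply_eq, he, LinearEquiv.apply_symm_apply]⟩
  hom_inv_id := SigmaModule.Hom.ext (LinearMap.ext fun m => e.symm_apply_apply m)
  inv_hom_id := SigmaModule.Hom.ext (LinearMap.ext fun m => e.apply_symm_apply m)

/-- A linear equivalence that commutes with the endomorphisms is an isomorphism. -/
def HiggsModule.isoMk {B : Type u} [CommRing B] {H K : HiggsModule B}
    (e : H.carrier ≃ₗ[B] K.carrier) (he : ∀ h, e (H.endo h) = K.endo (e h)) : H ≅ K where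
  hom := ⟨e, he⟩
  inv := ⟨e.symm, fun n => by
    rw [LinearEquiv.coe_coe, LinearEquiv.symm_apply_eq, he, LinearEquiv.apply_symm_apply]⟩
  hom_inv_id := HiggsModule.Hom.ext (LinearMap.ext fun m => e.symm_apply_apply m)
  inv_hom_id := HiggsModule.Hom.ext (LinearMap.ext fun m => e.apply_symm_apply m)

/-! ### Relative Frobenius compatible with `σ` -/

section Datum

variable {R A B : Type u} [CommRing R] [CommRing A] [CommRing B] [Algebra R A] [Algebra R B]
  [Algebra B A] {p : ℕ} {q : R} {x : A} {σ : A →ₐ[R] A} {d : A →+ A}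

variable (p B q x σ d) in
/-- The map `B → A` is a relative Frobenius compatible with `σ`, and `d` is the associated
`σ`-derivation. -/
structure IsFrobeniusDatum : Prop where
  two_le : 2 ≤ p
  qInt_eq_zero : qInt (algebraMap R B q) p = 0
  isUnit_qInt : ∀ m, 0 < m → m < p → IsUnit (qInt (algebraMap R B q) m)
  map_x : σ x = q • x
  map_algebraMap : ∀ b : B, σ (algebraMap B A b) = algebraMap B A b
  existsUnique_sum : ∀ a : A, ∃! c : Fin p → B, a = ∑ i, algebraMap B A (c i) * x ^ (i : ℕ)
  exists_pow : ∃ y : B, algebraMap B A y = x ^ p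
  isSigmaDerivation : IsSigmaDerivation σ d d
  der_x : d x = 1
  der_algebraMap : ∀ b : B, d (algebraMap B A b) = 0

namespace IsFrobeniusDatum

variable (h : IsFrobeniusDatum B p q x σ d)
include h

lemma powersSpan : PowersSpan p B x := fun a => (h.existsUnique_sum a).exists

/-- `σ` as a homomorphism of `B`-algebras. -/
def sigma : A →ₐ[B] A := { σ with commutes' := h.map_algebraMap }

lemma der_mul (a b : A) : d (a * b) = d a * b + σ a * d b := h.isSigmaDerivation.leibniz a b

/-- The `σ`-derivation of `A` as a `B`-linear map. -/
def der : A →ₗ[B] A where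
  toFun := d
  map_add' := d.map_add
  map_smul' b a := by
    rw [Algebra.smul_def, h.der_mul, h.der_algebraMap, h.map_algebraMap, zero_mul, zero_add,
      Algebra.smul_def, RingHom.id_apply]

lemma der_apply (a : A) : h.der a = d a := rfl

lemma der_one : h.der 1 = 0 := by rw [der_apply, ← map_one (algebraMap B A), h.der_algebraMap]

section Module

variable {M : SigmaModule σ d}

/-- The `σ`-derivation of a module as a `B`-linear map. -/
def moduleDer (M : SigmaModule σ d) [Module B M.carrier] [IsScalarTower B A M.carrier] :
    M.carrier →ₗ[B] M.carrier where
  toFun := M.der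
  map_add' := M.der.map_add
  map_smul' b m := by
    rw [← algebraMap_smul A b m, M.isSigmaDerivation.leibniz, h.der_algebraMap, h.map_algebraMap,
      zero_smul, zero_add, algebraMap_smul, RingHom.id_apply]

lemma moduleDer_apply [Module B M.carrier] [IsScalarTower B A M.carrier] (m : M.carrier) :
    h.moduleDer M m = M.der m := rfl

variable [IsScalarTower R B A]

omit h in
lemma Phi_algebraMap (n : ℕ) : Phi p (algebraMap R B q) x n = Phi p q x n := by
  simp only [Phi, aeval_algebraMap_apply, ← IsScalarTower.algebraMap_apply]

lemma map_x' : σ x = algebraMap R B q • x := by rw [algebraMap_smul]; exact h.map_x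

lemma moduleDer_smul [Module B M.carrier] [IsScalarTower B A M.carrier] (m : M.carrier) :
    h.moduleDer M (x • m) = m + algebraMap R B q • x • h.moduleDer M m := by
  rw [moduleDer_apply, M.isSigmaDerivation.leibniz, h.der_x, one_smul, h.map_x', smul_assoc,
    moduleDer_apply]

lemma isHiggsOperator_iff [Module B M.carrier] [IsScalarTower B A M.carrier] {y : B}
    (hy : algebraMap B A y = x ^ p) (hP : QuasiNilpotent (h.moduleDer M ^ p))
    (u : Module.End A M.carrier) : IsHiggsOperator p q x M u ↔
      ∀ m, u m = higgsOp p (algebraMap R B q) y (h.moduleDer M) hP m := by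
  rw [← isHiggs_iff h.two_le h.isUnit_qInt hy hP, IsHiggsOperator, Phi_algebraMap]
  rfl

variable (M) in
lemma existsUnique_isHiggsOperator :
    ∃! u : Module.End A M.carrier, IsHiggsOperator p q x M u := by
  let _ : Module B M.carrier := Module.compHom M.carrier (algebraMap B A)
  have _ : IsScalarTower B A M.carrier := .of_algebraMap_smul fun _ _ => rfl
  obtain ⟨y, hy⟩ := h.exists_pow
  have hp := h.two_le
  have hP : QuasiNilpotent (h.moduleDer M ^ p) :=
    quasiNilpotent_pow (by omega) (D := h.moduleDer M) M.quasiNilpotent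
  simp only [h.isHiggsOperator_iff hy hP]
  refine ⟨{ higgsOp p (algebraMap R B q) y (h.moduleDer M) hP with
    map_smul' := higgsOp_smul h.powersSpan h.qInt_eq_zero h.moduleDer_smul hP }, fun _ => rfl,
    fun v hv => LinearMap.ext hv⟩

variable {u : Module.End A M.carrier}

/-- A morphism intertwines the `p`-th powers of the derivations, hence also the operators obtained
from them by locally finite polynomial expressions. -/
lemma map_isHiggsOperator {N : SigmaModule σ d} {v : Module.End A N.carrier}
    (hu : IsHiggsOperator p q x M u) (hv : IsHiggsOperator p q x N v)
    (f : M.carrier →ₗ[A] N.carrier) (hf : ∀ m, f (M.der m) = N.der (f m)) (m : M.carrier) :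
    f (u m) = v (f m) := by
  let _ : Module B M.carrier := Module.compHom M.carrier (algebraMap B A)
  have _ : IsScalarTower B A M.carrier := .of_algebraMap_smul fun _ _ => rfl
  let _ : Module B N.carrier := Module.compHom N.carrier (algebraMap B A)
  have _ : IsScalarTower B A N.carrier := .of_algebraMap_smul fun _ _ => rfl
  obtain ⟨y, hy⟩ := h.exists_pow
  have hp := h.two_le
  have hP : QuasiNilpotent (h.moduleDer M ^ p) :=
    quasiNilpotent_pow (by omega) (D := h.moduleDer M) M.quasiNilpotent
  have hP' : QuasiNilpotent (h.moduleDer N ^ p) :=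
    quasiNilpotent_pow (by omega) (D := h.moduleDer N) N.quasiNilpotent
  rw [(h.isHiggsOperator_iff hy hP u).mp hu, (h.isHiggsOperator_iff hy hP' v).mp hv]
  exact map_higgsOp hP hP' (f := f.restrictScalars B) hf m

lemma der_isHiggsOperator (hu : IsHiggsOperator p q x M u) (m : M.carrier) :
    M.der (u m) = u (M.der m) := by
  let _ : Module B M.carrier := Module.compHom M.carrier (algebraMap B A)
  have _ : IsScalarTower B A M.carrier := .of_algebraMap_smul fun _ _ => rfl
  obtain ⟨y, hy⟩ := h.exists_pow
  have hp := h.two_le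
  have hP : QuasiNilpotent (h.moduleDer M ^ p) :=
    quasiNilpotent_pow (by omega) (D := h.moduleDer M) M.quasiNilpotent
  rw [(h.isHiggsOperator_iff hy hP u).mp hu, (h.isHiggsOperator_iff hy hP u).mp hu]
  exact map_higgsOp_self hP m

/-- The condition for `k = 1` is `∇ m = 0`, and it implies all the others. -/
lemma mem_higgsSet_iff (hu : IsHiggsOperator p q x M u) (m : M.carrier) :
    m ∈ higgsSet p q x M u ↔ M.der m = x ^ (p - 1) • u m := by
  let _ : Module B M.carrier := Module.compHom M.carrier (algebraMap B A)
  have _ : IsScalarTower B A M.carrier := .of_algebraMap_smul fun _ _ => rfl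
  have hp := h.two_le
  have h1 := forall_iterate_eq_iff (p := p) (by omega) h.qInt_eq_zero h.moduleDer_smul
    (h.der_isHiggsOperator hu) m
  rw [nabla_apply, sub_eq_zero] at h1
  simp only [Phi_algebraMap] at h1
  exact h1

lemma sum_pow_smul_eq_zero (hu : IsHiggsOperator p q x M u) {k : ℕ → M.carrier}
    (hk : ∀ i, k i ∈ higgsSet p q x M u) (h0 : ∑ i ∈ Finset.range p, x ^ i • k i = 0) :
    ∀ i < p, k i = 0 := by
  let _ : Module B M.carrier := Module.compHom M.carrier (algebraMap B A)
  have _ : IsScalarTower B A M.carrier := .of_algebraMap_smul fun _ _ => rfl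
  obtain ⟨y, hy⟩ := h.exists_pow
  have hp := h.two_le
  refine eq_zero_of_sum_pow_smul_eq_zero (D := h.moduleDer M) (by omega) hy h.isUnit_qInt hu.1
    h.moduleDer_smul (h.der_isHiggsOperator hu) le_rfl (fun i => ?_) h0
  rw [nabla_apply, sub_eq_zero]
  exact (h.mem_higgsSet_iff hu _).mp (hk i)

lemma exists_sum_pow_smul (hu : IsHiggsOperator p q x M u) (m : M.carrier) :
    ∃ k : ℕ → M.carrier, (∀ i, k i ∈ higgsSet p q x M u) ∧
      ∑ i ∈ Finset.range p, x ^ i • k i = m := by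
  let _ : Module B M.carrier := Module.compHom M.carrier (algebraMap B A)
  have _ : IsScalarTower B A M.carrier := .of_algebraMap_smul fun _ _ => rfl
  obtain ⟨y, hy⟩ := h.exists_pow
  have hp := h.two_le
  have h1 := iterate_prime_eq (by omega) h.qInt_eq_zero h.isUnit_qInt h.moduleDer_smul
    (h.der_isHiggsOperator hu) m
  rw [Phi_algebraMap, hu.2 m] at h1
  -- The defining equation of `u` cancels the two `p`-th powers in `D ^ p = Φ_p(u) + ∇ ^ p`.
  have h2 : (nabla p x (h.moduleDer M) u ^ p) m = 0 := by
    rw [Module.End.pow_apply]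
    exact left_eq_add.mp h1
  obtain ⟨k, hk, hs⟩ := exists_sum_pow_smul_eq (by omega) hy h.isUnit_qInt hu.1
    h.moduleDer_smul (h.der_isHiggsOperator hu) le_rfl m h2
  refine ⟨k, fun i => (h.mem_higgsSet_iff hu _).mpr ?_, hs⟩
  exact sub_eq_zero.mp (hk i)

end Module

/-! ### The functor `𝓗` -/

variable [IsScalarTower R B A]

/-- The operator `u` of a module with `σ`-derivation. -/
noncomputable def endo (M : SigmaModule σ d) : Module.End A M.carrier :=
  (h.existsUnique_isHiggsOperator M).choose

lemma isHiggsOperator_endo (M : SigmaModule σ d) : IsHiggsOperator p q x M (h.endo M) :=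
  (h.existsUnique_isHiggsOperator M).choose_spec.1

lemma eq_endo {M : SigmaModule σ d} {u : Module.End A M.carrier} (hu : IsHiggsOperator p q x M u) :
    u = h.endo M :=
  (h.existsUnique_isHiggsOperator M).unique hu (h.isHiggsOperator_endo M)

/-- The set of all `m` with `∂ m = x ^ (p - 1) u m`, as a `B`-submodule. -/
noncomputable def sections (M : SigmaModule σ d) :
    @Submodule B M.carrier _ _ (Module.compHom M.carrier (algebraMap B A)) :=
  let _ : Module B M.carrier := Module.compHom M.carrier (algebraMap B A)
  { carrier := {m | M.der m = x ^ (p - 1) • h.endo M m}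
    zero_mem' := by simp
    add_mem' := fun {a b} (ha : M.der a = _) (hb : M.der b = _) => by
      rw [Set.mem_ofPred_eq, map_add, ha, hb, map_add, smul_add]
    smul_mem' := fun b m (hm : M.der m = _) => by
      change M.der (algebraMap B A b • m) = x ^ (p - 1) • h.endo M (algebraMap B A b • m)
      rw [M.isSigmaDerivation.leibniz, h.der_algebraMap, zero_smul, zero_add, h.map_algebraMap, hm,
        map_smul, smul_comm] }

lemma mem_sections {M : SigmaModule σ d} {m : M.carrier} :
    m ∈ h.sections M ↔ M.der m = x ^ (p - 1) • h.endo M m := Iff.rfl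

lemma mem_sections_iff_mem_higgsSet {M : SigmaModule σ d} {m : M.carrier} :
    m ∈ h.sections M ↔ m ∈ higgsSet p q x M (h.endo M) :=
  (h.mem_higgsSet_iff (h.isHiggsOperator_endo M) m).symm

lemma endo_mem_sections {M : SigmaModule σ d} {m : M.carrier} (hm : m ∈ h.sections M) :
    h.endo M m ∈ h.sections M := by
  rw [mem_sections] at hm ⊢
  rw [h.der_isHiggsOperator (h.isHiggsOperator_endo M), hm, map_smul]

/-- The module with endomorphism `(H, u|_H)` of a module with `σ`-derivation. -/
noncomputable def higgsModule (M : SigmaModule σ d) : HiggsModule B :=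
  let _ : Module B M.carrier := Module.compHom M.carrier (algebraMap B A)
  { carrier := h.sections M
    endo :=
      { toFun := fun m => ⟨h.endo M m, h.endo_mem_sections m.2⟩
        map_add' := fun a b => Subtype.ext (map_add (h.endo M) a.1 b.1)
        map_smul' := fun b m => Subtype.ext (map_smul (h.endo M) (algebraMap B A b) m.1) }
    quasiNilpotent := fun m => by
      obtain ⟨n, hn⟩ := (h.isHiggsOperator_endo M).1 m.1
      refine ⟨n, Subtype.ext (Eq.trans ?_ hn)⟩
      exact Function.Semiconj.iterate_right (f := Subtype.val) (gb := h.endo M) (fun _ => rfl) n m }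

/-- The inclusion of `H` into `M`. -/
noncomputable def incl (M : SigmaModule σ d) : (h.higgsModule M).carrier →+ M.carrier where
  toFun m := Subtype.val (p := (· ∈ h.sections M)) m
  map_zero' := rfl
  map_add' _ _ := rfl

lemma incl_injective (M : SigmaModule σ d) : Function.Injective (h.incl M) :=
  Subtype.val_injective (p := (· ∈ h.sections M))

lemma incl_smul (M : SigmaModule σ d) (b : B) (m : (h.higgsModule M).carrier) :
    h.incl M (b • m) = algebraMap B A b • h.incl M m := rfl

lemma incl_endo (M : SigmaModule σ d) (m : (h.higgsModule M).carrier) :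
    h.incl M ((h.higgsModule M).endo m) = h.endo M (h.incl M m) := rfl

lemma incl_mem (M : SigmaModule σ d) (m : (h.higgsModule M).carrier) :
    h.incl M m ∈ h.sections M := Subtype.prop (p := (· ∈ h.sections M)) m

lemma range_incl (M : SigmaModule σ d) : Set.range (h.incl M) = higgsSet p q x M (h.endo M) := by
  ext m
  rw [← h.mem_sections_iff_mem_higgsSet]
  exact ⟨fun ⟨k, hk⟩ => hk ▸ h.incl_mem M k, fun hm => ⟨⟨m, hm⟩, rfl⟩⟩

/-- The functor `𝓗`. -/
noncomputable def functorH : SigmaModule σ d ⥤ HiggsModule B where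
  obj M := h.higgsModule M
  map {M N} f :=
    { toLin :=
        { toFun := fun m => ⟨f.toLin (h.incl M m), by
            have hm := h.mem_sections.mp (h.incl_mem M m)
            rw [mem_sections, ← f.comm, hm, map_smul, h.map_isHiggsOperator
              (h.isHiggsOperator_endo M) (h.isHiggsOperator_endo N) f.toLin f.comm]⟩
          map_add' := fun a b => Subtype.ext (map_add f.toLin (h.incl M a) (h.incl M b))
          map_smul' := fun b m => Subtype.ext (map_smul f.toLin (algebraMap B A b) (h.incl M m)) }
      comm := fun m => Subtype.ext (h.map_isHiggsOperator
        (h.isHiggsOperator_endo M) (h.isHiggsOperator_endo N) f.toLin f.comm (h.incl M m)) }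
  map_id _ := rfl
  map_comp _ _ := rfl

lemma isFunctorH : IsFunctorH p q x (algebraMap B A) h.functorH := by
  refine ⟨h.incl, h.incl_injective, h.incl_smul, fun M u hu => ?_, fun M N f m => rfl⟩
  rw [h.eq_endo hu]
  exact ⟨h.range_incl M, h.incl_endo M⟩

end IsFrobeniusDatum

end Datum

/-! ### The pullback as an ordinary tensor product -/

section Pullback

variable {B A : Type u} [CommRing B] [CommRing A] [Algebra B A] (H : Type u) [AddCommGroup H]
  [Module B H]

variable (B A) in
/-- The identity map from `A` to `Via (algebraMap B A)`. -/
def viaEquiv : A ≃ₗ[B] Via (algebraMap B A) where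
  toFun := Via.of (algebraMap B A)
  invFun a := a
  map_add' _ _ := rfl
  map_smul' b a := by rw [Algebra.smul_def, map_mul]; rfl
  left_inv _ := rfl
  right_inv _ := rfl

lemma congr_viaEquiv_smul (a : A) (t : A ⊗[B] H) :
    TensorProduct.congr (viaEquiv B A) (LinearEquiv.refl B H) (a • t)
      = Via.of (algebraMap B A) a •
        TensorProduct.congr (viaEquiv B A) (LinearEquiv.refl B H) t := by
  induction t using TensorProduct.induction_on with
  | zero => simp
  | tmul b h => rfl
  | add s t hs ht => rw [smul_add, map_add, hs, ht, map_add, smul_add]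

/-- The pullback along `B → A` is the tensor product. -/
noncomputable def pullbackEquiv : A ⊗[B] H ≃ₗ[A] Pullback (algebraMap B A) H :=
  { TensorProduct.congr (viaEquiv B A) (LinearEquiv.refl B H) with
    map_smul' := congr_viaEquiv_smul H }

variable {H} in
lemma linearMap_ext_one_tmul {N : Type u} [AddCommGroup N] [Module A N]
    {f g : A ⊗[B] H →ₗ[A] N} (hfg : ∀ k, f (1 ⊗ₜ k) = g (1 ⊗ₜ k)) : f = g := by
  ext t
  induction t using TensorProduct.induction_on with
  | zero => rw [map_zero, map_zero]
  | tmul a k =>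
    have h2 : a ⊗ₜ[B] k = a • (1 ⊗ₜ[B] k) := by
      rw [TensorProduct.smul_tmul', smul_eq_mul, mul_one]
    rw [h2, map_smul, map_smul, hfg]
  | add s t hs ht => rw [map_add, map_add, hs, ht]

lemma pullbackEquiv_tmul (a : A) (h : H) :
    pullbackEquiv H (a ⊗ₜ[B] h) = Pullback.tmul (algebraMap B A) a h := rfl

end Pullback

/-! ### The functor from Higgs modules and the equivalence -/

namespace IsFrobeniusDatum

variable {R A B : Type u} [CommRing R] [CommRing A] [CommRing B] [Algebra R A] [Algebra R B]
  [Algebra B A] [IsScalarTower R B A] {p : ℕ} {q : R} {x : A} {σ : A →ₐ[R] A} {d : A →+ A}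

variable (h : IsFrobeniusDatum B p q x σ d)
include h

section BaseChange

variable {H : Type u} [AddCommGroup H] [Module B H] {u : Module.End B H}

omit [IsScalarTower R B A] in
lemma tensorDer_smul (a : A) (t : A ⊗[B] H) : tensorDer p x h.sigma h.der u (a • t)
    = d a • t + σ a • tensorDer p x h.sigma h.der u t :=
  QSimpson.tensorDer_smul h.der_mul a t

lemma tensorDer_x_smul (t : A ⊗[B] H) : tensorDer p x h.sigma h.der u (x • t)
    = t + algebraMap R B q • x • tensorDer p x h.sigma h.der u t := by
  rw [h.tensorDer_smul, h.der_x, one_smul, h.map_x', smul_assoc]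

lemma isSigmaDerivation_tensorDer :
    IsSigmaDerivation σ d (tensorDer p x h.sigma h.der u).toAddMonoidHom where
  map_algebraMap_smul r t := by
    have h1 := h.tensorDer_smul (u := u) (algebraMap R A r) t
    have h2 : d (algebraMap R A r) = 0 := by
      rw [IsScalarTower.algebraMap_apply R B A, h.der_algebraMap]
    rwa [σ.commutes, h2, zero_smul, zero_add] at h1
  leibniz a t := h.tensorDer_smul a t

end BaseChange

/-- The module `A ⊗ H` with its `σ`-derivation. -/
noncomputable def tensorModule (H : HiggsModule B) : SigmaModule σ d where
  carrier := A ⊗[B] H.carrier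
  der := (tensorDer p x h.sigma h.der H.endo).toAddMonoidHom
  isSigmaDerivation := h.isSigmaDerivation_tensorDer
  quasiNilpotent := quasiNilpotent_tensorDer h.two_le h.qInt_eq_zero h.powersSpan
    h.tensorDer_x_smul h.der_one H.quasiNilpotent

lemma tensorModule_der_one_tmul (H : HiggsModule B) (k : H.carrier) :
    (h.tensorModule H).der ((1 : A) ⊗ₜ[B] k) = (x ^ (p - 1) : A) ⊗ₜ[B] H.endo k :=
  tensorDer_one_tmul h.der_one k

/-- By uniqueness of the operator `u`, it is enough that `id ⊗ u` is quasi-nilpotent and solves its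
equation. -/
lemma endo_tensorModule (H : HiggsModule B) :
    h.endo (h.tensorModule H) = H.endo.baseChange A := by
  refine (h.eq_endo (M := h.tensorModule H) (u := H.endo.baseChange A) ⟨?_, fun t => ?_⟩).symm
  · exact quasiNilpotent_baseChange H.quasiNilpotent
  · rw [← Phi_algebraMap (B := B)]
    exact aeval_Phi_baseChange h.two_le h.qInt_eq_zero h.powersSpan h.tensorDer_x_smul h.der_one t

lemma mem_sections_tensorModule (H : HiggsModule B) (t : A ⊗[B] H.carrier) :
    t ∈ h.sections (h.tensorModule H) ↔ ∃ k, (1 : A) ⊗ₜ[B] k = t := by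
  obtain ⟨y, hy⟩ := h.exists_pow
  refine (h.mem_sections (M := h.tensorModule H) (m := t)).trans ?_
  rw [endo_tensorModule]
  exact sub_eq_zero.symm.trans (nabla_eq_zero_iff h.two_le h.qInt_eq_zero h.powersSpan
    h.tensorDer_x_smul h.der_one h.isUnit_qInt hy H.quasiNilpotent t)

omit [IsScalarTower R B A] in
/-- Morphisms of `A`-modules out of `A ⊗ H` that commute with the `σ`-derivations can be tested on
`H`. -/
lemma comm_of_forall_tmul (H : HiggsModule B) {N : SigmaModule σ d}
    (f : A ⊗[B] H.carrier →ₗ[A] N.carrier)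
    (hf : ∀ k, f ((x ^ (p - 1) : A) ⊗ₜ[B] H.endo k) = N.der (f (1 ⊗ₜ k)))
    (t : A ⊗[B] H.carrier) :
    f (tensorDer p x h.sigma h.der H.endo t) = N.der (f t) := by
  induction t using TensorProduct.induction_on with
  | zero => simp only [map_zero]
  | tmul a k =>
    have h2 : a ⊗ₜ[B] k = a • (1 ⊗ₜ[B] k) := by
      rw [TensorProduct.smul_tmul', smul_eq_mul, mul_one]
    rw [h2, map_smul f, N.isSigmaDerivation.leibniz, h.tensorDer_smul, map_add, map_smul f,
      map_smul f, tensorDer_one_tmul h.der_one, hf]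
  | add s t hs ht => simp only [map_add, hs, ht]

/-- The functor `𝓜`. -/
noncomputable def functorM : HiggsModule B ⥤ SigmaModule σ d where
  obj H := h.tensorModule H
  map {H K} g := ⟨g.toLin.baseChange A, h.comm_of_forall_tmul H (N := h.tensorModule K)
    (g.toLin.baseChange A) fun k => by
      change g.toLin.baseChange A ((x ^ (p - 1) : A) ⊗ₜ[B] H.endo k)
        = tensorDer p x h.sigma h.der K.endo (g.toLin.baseChange A ((1 : A) ⊗ₜ[B] k))
      rw [LinearMap.baseChange_tmul, LinearMap.baseChange_tmul, g.comm,
        tensorDer_one_tmul h.der_one]⟩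
  map_id H := SigmaModule.Hom.ext (LinearMap.baseChange_id)
  map_comp f g := SigmaModule.Hom.ext (LinearMap.baseChange_comp f.toLin g.toLin)

lemma isFunctorM : IsFunctorM p x (algebraMap B A) h.functorM := by
  refine ⟨fun H => (pullbackEquiv H.carrier).symm, fun H k => ?_, fun H K g a k => ?_⟩
  · exact h.tensorModule_der_one_tmul H k
  · exact LinearMap.baseChange_tmul _ _ _

/-- The isomorphism `A ⊗ H(M) ≃ M`. -/
lemma exists_tensor_sections_equiv (M : SigmaModule σ d) :
    ∃ e : (A ⊗[B] (h.higgsModule M).carrier) ≃ₗ[A] M.carrier,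
      ∀ a k, e (a ⊗ₜ k) = a • h.incl M k := by
  let _ : Module B M.carrier := Module.compHom M.carrier (algebraMap B A)
  have _ : IsScalarTower B A M.carrier := .of_algebraMap_smul fun _ _ => rfl
  let ι : (h.higgsModule M).carrier →ₗ[B] M.carrier :=
    { h.incl M with map_smul' := h.incl_smul M }
  have hι : ∀ a k, ι.liftBaseChange A (a ⊗ₜ k) = a • h.incl M k := fun a k => by
    rw [LinearMap.liftBaseChange_tmul]; rfl
  have hu := h.isHiggsOperator_endo M
  -- Injectivity and surjectivity are the directness and the exhaustion in `M = ⊕ x ^ i H`, `i < p`.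
  have hbij : Function.Bijective (ι.liftBaseChange A) := by
    constructor
    · rw [injective_iff_map_eq_zero]
      intro t ht
      obtain ⟨k, rfl⟩ := h.powersSpan.exists_sum_tmul t
      simp only [map_sum, map_smul, hι, one_smul] at ht
      have h0 := h.sum_pow_smul_eq_zero hu
        (fun i => h.mem_sections_iff_mem_higgsSet.mp (h.incl_mem M (k i))) ht
      refine Finset.sum_eq_zero fun i hi => ?_
      have hk : k i = 0 := h.incl_injective M
        ((h0 i (Finset.mem_range.mp hi)).trans (map_zero (h.incl M)).symm)
      rw [hk, TensorProduct.tmul_zero, smul_zero]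
    · intro m
      obtain ⟨k, hk, rfl⟩ := h.exists_sum_pow_smul hu m
      let k' : ℕ → (h.higgsModule M).carrier :=
        fun i => ⟨k i, h.mem_sections_iff_mem_higgsSet.mpr (hk i)⟩
      refine ⟨∑ i ∈ Finset.range p, (x ^ i) • (1 : A) ⊗ₜ[B] k' i, ?_⟩
      simp only [map_sum, map_smul, hι, one_smul]
      rfl
  exact ⟨LinearEquiv.ofBijective _ hbij, hι⟩

/-- The isomorphism `A ⊗ H(M) ≃ M` in the category of modules with a `σ`-derivation. -/
noncomputable def tensorSectionsIso (M : SigmaModule σ d) : h.functorM.obj (h.functorH.obj M) ≅ M :=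
  SigmaModule.isoMk (h.exists_tensor_sections_equiv M).choose
    (h.comm_of_forall_tmul (h.higgsModule M) (N := M)
      (h.exists_tensor_sections_equiv M).choose.toLinearMap fun k => by
        have he := (h.exists_tensor_sections_equiv M).choose_spec
        rw [LinearEquiv.coe_coe, he, he, one_smul, incl_endo]
        exact (h.mem_sections.mp (h.incl_mem M k)).symm)

lemma tensorSectionsIso_hom_tmul (M : SigmaModule σ d) (a : A) (k : (h.higgsModule M).carrier) :
    (h.tensorSectionsIso M).hom.toLin (a ⊗ₜ[B] k) = a • h.incl M k :=
  (h.exists_tensor_sections_equiv M).choose_spec a k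

/-- The isomorphism `H ≃ H(A ⊗ H)`. -/
noncomputable def sectionsTensorIso (H : HiggsModule B) :
    H ≅ h.functorH.obj (h.functorM.obj H) :=
  let ι : H.carrier →ₗ[B] (h.higgsModule (h.tensorModule H)).carrier :=
    { toFun := fun k => ⟨(1 : A) ⊗ₜ[B] k, (h.mem_sections_tensorModule H _).mpr ⟨k, rfl⟩⟩
      map_add' := fun a b => Subtype.ext (TensorProduct.tmul_add _ _ _)
      map_smul' := fun b k => Subtype.ext (by
        change (1 : A) ⊗ₜ[B] (b • k) = algebraMap B A b • ((1 : A) ⊗ₜ[B] k)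
        rw [algebraMap_smul, TensorProduct.tmul_smul]) }
  HiggsModule.isoMk (LinearEquiv.ofBijective ι (by
    constructor
    · intro k k' hk
      obtain ⟨b, hb⟩ := exists_basis_pow h.existsUnique_sum
      have hp := h.two_le
      exact one_tmul_injective (H := H.carrier) (by omega) b hb (congrArg Subtype.val hk)
    · intro t
      obtain ⟨k, hk⟩ := (h.mem_sections_tensorModule H t.1).mp t.2
      exact ⟨k, Subtype.ext hk⟩)) fun k => h.incl_injective _
      ((LinearMap.congr_fun (h.endo_tensorModule H) ((1 : A) ⊗ₜ[B] k)).trans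
        (LinearMap.baseChange_tmul (A := A) H.endo 1 k)).symm

/-- The equivalence between modules with a quasi-nilpotent `σ`-derivation and modules with a
quasi-nilpotent endomorphism. -/
noncomputable def equivalence : SigmaModule σ d ≌ HiggsModule B :=
  CategoryTheory.Equivalence.mk h.functorH h.functorM
    (NatIso.ofComponents (fun M => (h.tensorSectionsIso M).symm) fun {M N} f => by
      rw [Iso.symm_hom, Iso.symm_hom, Iso.comp_inv_eq, Category.assoc, Iso.eq_inv_comp]
      refine SigmaModule.Hom.ext (linearMap_ext_one_tmul (N := N.carrier) fun k => ?_)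
      change f.toLin ((h.tensorSectionsIso M).hom.toLin ((1 : A) ⊗ₜ[B] k))
        = (h.tensorSectionsIso N).hom.toLin ((1 : A) ⊗ₜ[B] (h.functorH.map f).toLin k)
      have h1 := (congrArg f.toLin (h.tensorSectionsIso_hom_tmul M 1 k)).trans
        (map_smul f.toLin 1 _)
      exact h1.trans (h.tensorSectionsIso_hom_tmul N 1 ((h.functorH.map f).toLin k)).symm)
    (NatIso.ofComponents (fun H => (h.sectionsTensorIso H).symm) fun {H K} g => by
      rw [Iso.symm_hom, Iso.symm_hom, Iso.comp_inv_eq, Category.assoc, Iso.eq_inv_comp]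
      refine HiggsModule.Hom.ext (LinearMap.ext fun k => h.incl_injective _ ?_)
      exact LinearMap.baseChange_tmul (A := A) g.toLin 1 k)

lemma quasiNilpotent_self : QuasiNilpotent d := by
  have hp := h.two_le
  refine fun a => ⟨p, iterate_prime_self h.powersSpan h.qInt_eq_zero (d := h.der) h.der_one
    (fun a => ?_) (by omega) a⟩
  rw [der_apply, h.der_mul, h.der_x, one_mul, h.map_x', smul_mul_assoc, der_apply]

/-- The pair `(B, 0)` corresponds to `(A, d)`. -/
noncomputable def functorMTrivialIso : h.functorM.obj (HiggsModule.trivial B) ≅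
    SigmaModule.self h.isSigmaDerivation h.quasiNilpotent_self :=
  SigmaModule.isoMk (N := SigmaModule.self h.isSigmaDerivation h.quasiNilpotent_self)
    (TensorProduct.AlgebraTensorModule.rid B A A)
    (h.comm_of_forall_tmul (HiggsModule.trivial B)
      (N := SigmaModule.self h.isSigmaDerivation h.quasiNilpotent_self)
      (TensorProduct.AlgebraTensorModule.rid B A A).toLinearMap fun (k : B) => by
        change TensorProduct.AlgebraTensorModule.rid B A A ((x ^ (p - 1) : A) ⊗ₜ[B] (0 : B))
          = d (TensorProduct.AlgebraTensorModule.rid B A A ((1 : A) ⊗ₜ[B] k))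
        rw [TensorProduct.AlgebraTensorModule.rid_tmul, TensorProduct.AlgebraTensorModule.rid_tmul,
          zero_smul, Algebra.smul_def, mul_one, h.der_algebraMap])

/-- Existence is transported from `tensorDer`; uniqueness holds because the elements `1 ⊗ k`
generate the module over `A` and the Leibniz rule fixes the rest. -/
lemma existsUnique_der_pullback (H : HiggsModule B) :
    ∃! D : Pullback (algebraMap B A) H.carrier →+ Pullback (algebraMap B A) H.carrier,
      IsSigmaDerivation σ d D ∧ ∀ k, D (Pullback.tmul (algebraMap B A) 1 k) =
        Pullback.tmul (algebraMap B A) (x ^ (p - 1)) (H.endo k) := by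
  let e := pullbackEquiv (A := A) (B := B) H.carrier
  have hlin : ∀ a t, e.symm (a • t) = a • e.symm t := map_smul e.symm
  let D := (e.toLinearMap.toAddMonoidHom.comp
    (tensorDer p x h.sigma h.der H.endo).toAddMonoidHom).comp e.symm.toLinearMap.toAddMonoidHom
  have hDe : ∀ t, D t = e (tensorDer p x h.sigma h.der H.endo (e.symm t)) := fun _ => rfl
  have hder : IsSigmaDerivation σ d D :=
    { map_algebraMap_smul := fun r t => by
        rw [hDe, hDe, hlin, ← map_smul e]
        exact congrArg e (h.isSigmaDerivation_tensorDer.map_algebraMap_smul r _)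
      leibniz := fun a t => by
        rw [hDe, hDe, hlin, h.tensorDer_smul, map_add, map_smul, map_smul,
          LinearEquiv.apply_symm_apply] }
  have hone : ∀ k, D (Pullback.tmul (algebraMap B A) 1 k) =
      Pullback.tmul (algebraMap B A) (x ^ (p - 1)) (H.endo k) := fun k =>
    congrArg e (tensorDer_one_tmul (x := x) h.der_one k)
  refine ⟨D, ⟨hder, hone⟩, fun D' ⟨hder', hone'⟩ => ?_⟩
  ext t
  obtain ⟨t, rfl⟩ := e.surjective t
  induction t using TensorProduct.induction_on with
  | zero => simp only [map_zero]
  | tmul a k =>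
    have h2 : e (a ⊗ₜ[B] k) = a • Pullback.tmul (algebraMap B A) 1 k := by
      rw [← pullbackEquiv_tmul, ← map_smul, TensorProduct.smul_tmul', smul_eq_mul, mul_one]
    rw [h2, hder.leibniz, hder'.leibniz, hone, hone']
  | add s t hs ht => simp only [map_add, hs, ht]

end IsFrobeniusDatum

/-- Along an étale map, a `σ`-derivation is determined by its value at the coordinate. -/
lemma IsSigmaDerivation.eq_of_etale {R A : Type u} [CommRing R] [CommRing A] [Algebra R A]
    {σ : A →ₐ[R] A} {d d' : A →+ A} {q : R} (f : R[X] →ₐ[R] A) (hf : f.toRingHom.Etale)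
    (hσ : σ (f X) = q • f X) (hd : IsSigmaDerivation σ d d) (h1 : d (f X) = 1)
    (hd' : IsSigmaDerivation σ d' d') (h1' : d' (f X) = 1) : d' = d := by
  let _ : Algebra R[X] A := f.toRingHom.toAlgebra
  have _ : Algebra.Etale R[X] A := hf
  have hl : ∀ a b, d (a * b) = d a * b + σ a * d b := hd.leibniz
  have hl' : ∀ a b, d' (a * b) = d' a * b + σ a * d' b := hd'.leibniz
  have hδ : ∀ a b, (d' - d) (a * b) = (d' - d) a * b + σ a * (d' - d) b := fun a b => by
    rw [AddMonoidHom.sub_apply, AddMonoidHom.sub_apply, AddMonoidHom.sub_apply, hl, hl']; ring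
  have hx : (d' - d) (f X) = 0 := by rw [AddMonoidHom.sub_apply, h1, h1', sub_self]
  -- Compare the two Leibniz expansions of `d (a x) = d (x a)`. The same comparison for `d' - d`,
  -- which kills `x`, shows that `(q - 1) x` annihilates its values.
  have hσd : ∀ a, σ a = a + (algebraMap R A q - 1) * f X * d a := fun a => by
    have h := hl a (f X)
    rw [mul_comm, hl, h1, hσ, Algebra.smul_def] at h
    linear_combination -h
  have hann : ∀ a, (algebraMap R A q - 1) * f X * (d' - d) a = 0 := fun a => by
    have h := hδ a (f X)
    rw [mul_comm, hδ, hx, hσ, Algebra.smul_def] at h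
    linear_combination h
  -- Since `σ b - b` is a multiple of `(q - 1) x`, the twist disappears: the difference is an
  -- ordinary derivation. It vanishes on `R[X]`, and the Kähler differentials of an étale algebra
  -- are zero.
  have hder : ∀ a b, (d' - d) (a * b) = a * (d' - d) b + b * (d' - d) a := fun a b => by
    rw [hδ, hσd]
    linear_combination d a * hann b
  have hR : ∀ (r : R) (a : A), (d' - d) (algebraMap R A r * a) = algebraMap R A r * (d' - d) a :=
    fun r a => by
      have h2 := hd.map_algebraMap_smul r a
      have h3 := hd'.map_algebraMap_smul r a
      rw [smul_eq_mul, smul_eq_mul] at h2 h3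
      rw [AddMonoidHom.sub_apply, AddMonoidHom.sub_apply, h2, h3, mul_sub]
  have hpow : ∀ n : ℕ, (d' - d) (f X ^ n) = 0 := by
    intro n
    induction n with
    | zero =>
      have h := hder 1 1
      simpa using h
    | succ n ih => rw [pow_succ, hder, ih, hx, mul_zero, mul_zero, add_zero]
  have hpoly : ∀ g : R[X], (d' - d) (f g) = 0 := by
    intro g
    induction g using Polynomial.induction_on' with
    | add g h hg hh => rw [map_add, map_add, hg, hh, add_zero]
    | monomial n r =>
      rw [← C_mul_X_pow_eq_monomial, map_mul, map_pow, ← algebraMap_eq, AlgHom.commutes, hR, hpow,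
        mul_zero]
  let D : Derivation R[X] A A := Derivation.mk'
    { toFun := d' - d
      map_add' := map_add (d' - d)
      map_smul' := fun g a => by
        rw [Algebra.smul_def, Algebra.smul_def, RingHom.id_apply]
        change (d' - d) (f g * a) = f g * (d' - d) a
        rw [hder, hpoly, mul_zero, add_zero] } hder
  have hD : D = 0 := (KaehlerDifferential.linearMapEquivDerivation R[X] A).symm.injective
    (Subsingleton.elim _ _)
  ext a
  exact sub_eq_zero.mp (DFunLike.congr_fun hD a)

end QSimpson

/-! ### The main theorem -/

open QSimpson in
theorem mainTheorem1 (p : ℕ) (hp : p.Prime)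
    {R : Type u} [CommRing R] (F : R →+* R) (q : R)
    (hq : qInt q p = 0)
    (hdiv : ∀ m : ℕ, qInt q m ≠ 0 → IsUnit (qInt q m))
    {A : Type u} [CommRing A] [Algebra R A] (f : R[X] →ₐ[R] A)
    (σ : A →ₐ[R] A) (hσ : σ (f X) = q • f X)
    (Fr : FrobTwist F A →ₐ[R] A) (hFr : Fr (FrobTwist.of F A (f X)) = f X ^ p)
    (hσFr : ∀ b, σ (Fr b) = Fr b)
    (hbasis : ∀ a : A, ∃! c : Fin p → FrobTwist F A, a = ∑ i, Fr (c i) * f X ^ (i : ℕ)) :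
    ∃ d : A →+ A,
      (IsSigmaDerivation σ d d ∧ d (f X) = 1 ∧ ∀ b, d (Fr b) = 0) ∧
      (∀ d' : A →+ A, IsSigmaDerivation σ d' d' → d' (f X) = 1 → (∀ b, d' (Fr b) = 0) → d' = d) ∧
      (f.toRingHom.Etale →
        ∀ d' : A →+ A, IsSigmaDerivation σ d' d' → d' (f X) = 1 → d' = d) ∧
      (∀ M : SigmaModule σ d, ∃! v : Module.End A M.carrier, IsHiggsOperator p q (f X) M v) ∧
      (∀ H : HiggsModule (FrobTwist F A),
        ∃! D : Pullback Fr.toRingHom H.carrier →+ Pullback Fr.toRingHom H.carrier,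
          IsSigmaDerivation σ d D ∧
          ∀ h, D (Pullback.tmul Fr.toRingHom 1 h) =
            Pullback.tmul Fr.toRingHom (f X ^ (p - 1)) (H.endo h)) ∧
      ∃ e : SigmaModule σ d ≌ HiggsModule (FrobTwist F A),
        IsFunctorH p q (f X) Fr.toRingHom e.functor ∧
        IsFunctorM p (f X) Fr.toRingHom e.inverse ∧
        ∃ (h : IsSigmaDerivation σ d d) (hn : QuasiNilpotent d),
          Nonempty (e.functor.obj (SigmaModule.self h hn) ≅ HiggsModule.trivial (FrobTwist F A)) ∧
          Nonempty (e.inverse.obj (HiggsModule.trivial (FrobTwist F A)) ≅ SigmaModule.self h hn) := by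
  let _ : Algebra (FrobTwist F A) A := Fr.toRingHom.toAlgebra
  have _ : IsScalarTower R (FrobTwist F A) A := .of_algebraMap_eq fun r => (Fr.commutes r).symm
  have hunit : ∀ m, 0 < m → m < p → IsUnit (qInt (algebraMap R (FrobTwist F A) q) m) :=
    fun m h0 hm => by
      rw [← map_qInt]
      exact (isUnit_qInt_of_divisible hp hq hdiv h0 hm).map _
  have hqB : qInt (algebraMap R (FrobTwist F A) q) p = 0 := by rw [← map_qInt, hq, map_zero]
  have hbasis' : ∀ a : A, ∃! c : Fin p → FrobTwist F A,
      a = ∑ i, algebraMap (FrobTwist F A) A (c i) * f X ^ (i : ℕ) := hbasis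
  have hspan : PowersSpan p (FrobTwist F A) (f X) := fun a => (hbasis' a).exists
  have hσ' : σ (f X) = algebraMap R (FrobTwist F A) q • f X := by rw [hσ, algebraMap_smul]
  let σ' : A →ₐ[FrobTwist F A] A := { σ with commutes' := hσFr }
  obtain ⟨b, hb⟩ := exists_basis_pow hbasis'
  obtain ⟨d, hd1, hdx⟩ := exists_twisted_derivation hqB
    (y := FrobTwist.of F A (f X)) hFr hspan b hb
  have hleib : ∀ a c : A, d (a * c) = d a * c + σ a * d c :=
    hspan.leibniz (M := A) (σ := σ') hσ' (map_pow_eq hdx hd1) hdx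
  have hder : IsSigmaDerivation σ d.toAddMonoidHom d.toAddMonoidHom :=
    { map_algebraMap_smul := fun r a => by
        have h := map_smul d (algebraMap R (FrobTwist F A) r) a
        rwa [← algebraMap_smul A, ← algebraMap_smul A (algebraMap R (FrobTwist F A) r),
          ← IsScalarTower.algebraMap_apply] at h
      leibniz := hleib }
  have hdX : d (f X) = 1 := by simpa [hd1] using hdx 1
  have hdFr : ∀ b, d (Fr b) = 0 := fun b => by
    change d (algebraMap _ A b) = 0
    rw [Algebra.algebraMap_eq_smul_one, map_smul, hd1, smul_zero]
  have hdat : IsFrobeniusDatum (FrobTwist F A) p q (f X) σ d.toAddMonoidHom :=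
    { two_le := hp.two_le
      qInt_eq_zero := hqB
      isUnit_qInt := hunit
      map_x := hσ
      map_algebraMap := hσFr
      existsUnique_sum := hbasis'
      exists_pow := ⟨_, hFr⟩
      isSigmaDerivation := hder
      der_x := hdX
      der_algebraMap := hdFr }
  refine ⟨d.toAddMonoidHom, ⟨hder, hdX, hdFr⟩, fun d' hd' hX' hFr' => ?_, fun hf d' hd' hX' =>
    hder.eq_of_etale f hf hσ hdX hd' hX', fun M => hdat.existsUnique_isHiggsOperator M,
    hdat.existsUnique_der_pullback, hdat.equivalence, hdat.isFunctorH, hdat.isFunctorM, hder,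
    hdat.quasiNilpotent_self, ⟨?_⟩, ⟨hdat.functorMTrivialIso⟩⟩
  -- Any other candidate is also `A'`-linear and kills `1`, so the twisted Leibniz rule fixes it on
  -- the powers of `x`, which span `A`.
  · have hdat' : IsFrobeniusDatum (FrobTwist F A) p q (f X) σ d' :=
      { hdat with isSigmaDerivation := hd', der_x := hX', der_algebraMap := hFr' }
    have h := hspan.ext_of_map_mul (q := algebraMap R (FrobTwist F A) q) hdat'.der_one (fun a => by
      rw [hdat'.der_apply, hdat'.der_mul, hX', hσ', one_mul, smul_mul_assoc, hdat'.der_apply])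
      hd1 hdx
    ext a
    exact LinearMap.congr_fun h a
  -- Replace `(A, ∂_σ)` by the image of `(A', 0)` and use that the two functors are quasi-inverse.
  · exact hdat.functorH.mapIso hdat.functorMTrivialIso.symm ≪≫
      (hdat.sectionsTensorIso (HiggsModule.trivial (FrobTwist F A))).symm
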